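/- Let $\sigma$ be a finite relational signature with relation symbols $R_1,\dots,R_m$ of arities $k_1,\dots,k_m$, and let $\mathcal B=(\{0,1\},R_1^{\mathcal B},\dots,R_m^{\mathcal B})$ be a fixed $\sigma$-structure on the Boolean domain. Assume that $\mathcal B$ is 2-monotone: each relation $R_i^{\mathcal B}\subseteq\{0,1\}^{k_i}$ is defined by a formula of one of the forms $x_1\wedge\dots\wedge x_p$, $\;\overline{y_1}\wedge\dots\wedge\overline{y_q}$, $\;(x_1\wedge\dots\wedge x_p)\vee(\overline{y_1}\wedge\dots\wedge\overline{y_q})$, where the $x$'s and the $y$'s are coordinates of the tuple (empty conjunctions, which are true, are allowed). $\textsc{Max-Sur-CSP}(\mathcal B)$ is the following maximization problem. An instance is a finite $\sigma$-structure $\mathcal A=(A,R_1^{\mathcal A},\dots,R_m^{\mathcal A})$ with $|A|\ge 2$, given by $|A|$ and a list of the constraints of $\mathcal A$, that is, of the pairs $(i,a)$ with $a\in R_i^{\mathcal A}$. A solution is a surjective function $h:A\to\{0,1\}$. Its value is the number of constraints $(i,(a_1,\dots,a_{k_i}))$ of $\mathcal A$ with $(h(a_1),\dots,h(a_{k_i}))\in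 R_i^{\mathcal B}$. Then $\textsc{Max-Sur-CSP}(\mathcal B)$ is in the class PO. That is, it is an NP maximization problem (instances and solutions can be recognized in polynomial time, solutions are polynomially bounded in the size of the instance, and the value of a solution can be computed in polynomial time), and there is a (deterministic) polynomial-time algorithm which, given an instance $\mathcal A$, outputs a solution of maximum value. Here the size of an instance is $|\mathcal A|=|A|+|R_1^{\mathcal A}|+\dots+|R_m^{\mathcal A}|$, up to polynomial equivalence. -/

import Mathlib

open Turing Computability

/-! ### Polynomial time

Polynomial time is polynomial time on multi-stack Turing machines, as in Mathlib
(`Turing.TM2ComputableInPolyTime`). Such a machine has finitely many stacks, labels and internal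
states, and a symbol is pushed as a function of the label and the internal state only, so it uses
finitely many symbols on every stack. -/

/-- The function `f`, with word values, is computable in polynomial time from the code `ea a` of
its argument `a`; time is measured in the length of `ea a`. -/
def PolyTimeComputable {α Γ Δ : Type} (ea : α → List Γ) (f : α → List Δ) : Prop :=
  Nonempty (TM2ComputableInPolyTime ea (id : List Δ → List Δ) f)

open Classical in
/-- Membership in `S` is decidable in polynomial time from the code `ea a`. -/
def PolyTimeDecidable {α Γ : Type} (ea : α → List Γ) (S : Set α) : Prop :=
  PolyTimeComputable ea (fun a => encodeBool (decide (a ∈ S)))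

/-- The code of a pair of words, over the disjoint union of the two alphabets. -/
def encPair {Γ Δ : Type} (p : List Γ × List Δ) : List (Γ ⊕ Δ) :=
  p.1.map Sum.inl ++ p.2.map Sum.inr

/-! ### Maximization problems and the class PO -/

/-- A maximization problem: instances, the (feasible) solutions of each instance, the value of a
solution, and codes of instances and solutions as words. -/
structure MaxProblem where
  Inst : Type
  Sol : Inst → Type
  value : (I : Inst) → Sol I → ℕ
  InstSym : Type
  SolSym : Type
  encInst : Inst → List InstSym
  encSol : (I : Inst) → Sol I → List SolSym
  encInst_injective : Function.Injective encInst
  encSol_injective : ∀ I, Function.Injective (encSol I)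

namespace MaxProblem

/-- NP maximization problems: instances and solutions are recognizable in polynomial time, the
solutions are polynomially bounded in the size of the instance, and the objective function is
computable in polynomial time (with values written in binary). -/
def IsNPMaximization (P : MaxProblem) : Prop :=
  PolyTimeDecidable (id : List P.InstSym → List P.InstSym) (Set.range P.encInst) ∧
  PolyTimeDecidable (encPair : List P.InstSym × List P.SolSym → _)
    {p | ∃ (I : P.Inst) (x : P.Sol I), P.encInst I = p.1 ∧ P.encSol I x = p.2} ∧
  (∃ q : Polynomial ℕ, ∀ (I : P.Inst) (x : P.Sol I),
    (P.encSol I x).length ≤ q.eval (P.encInst I).length) ∧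
  PolyTimeComputable (fun y : (I : P.Inst) × P.Sol I => encPair (P.encInst y.1, P.encSol y.1 y.2))
    (fun y => encodeNat (P.value y.1 y.2))

/-- The class PO: NP maximization problems with a polynomial-time algorithm that outputs, for every
instance, an optimal solution of it. -/
def InPO (P : MaxProblem) : Prop :=
  P.IsNPMaximization ∧
  ∃ opt : (I : P.Inst) → P.Sol I,
    (∀ (I : P.Inst) (x : P.Sol I), P.value I x ≤ P.value I (opt I)) ∧
    PolyTimeComputable P.encInst (fun I => P.encSol I (opt I))

end MaxProblem

/-! ### Relational structures and Max-Sur-CSP -/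

/-- Relational structures with domain `D` over the signature with `m` relation symbols, of arities
`k 0, …, k (m - 1)`. -/
def RelStructure {m : ℕ} (k : Fin m → ℕ) (D : Type) : Type :=
  (i : Fin m) → Set (Fin (k i) → D)

/-- An instance of Max-Sur-CSP for a template with domain `D`: a finite relational structure, whose
domain is `Fin n` with `|D| ≤ n`, given by a list without repetitions of its constraints
(a constraint is a relation symbol `i` and a tuple in the relation `i`). -/
structure CSPInstance {m : ℕ} (k : Fin m → ℕ) (D : Type) where
  n : ℕ
  card_le : Nat.card D ≤ n
  constraints : List ((i : Fin m) × (Fin (k i) → Fin n))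
  nodup : constraints.Nodup

namespace CSPInstance

variable {m : ℕ} {k : Fin m → ℕ} {D : Type}

/-- The relational structure that the instance lists. -/
def toStructure (A : CSPInstance k D) : RelStructure k (Fin A.n) :=
  fun i => {t | ⟨i, t⟩ ∈ A.constraints}

/-- The number of constraints of `A` that the assignment `h` preserves, for the template `B`. -/
noncomputable def numSatisfied (B : RelStructure k D) (A : CSPInstance k D) (h : Fin A.n → D) : ℕ :=
  Set.ncard {c : (i : Fin m) × (Fin (k i) → Fin A.n) |
    c.2 ∈ A.toStructure c.1 ∧ h ∘ c.2 ∈ B c.1}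

end CSPInstance

/-- The alphabet for instances over `m` relation symbols. -/
inductive CSPSym (m : ℕ) : Type
  | one : CSPSym m
  | sep : CSPSym m
  | rel (i : Fin m) : CSPSym m

/-- Numbers are written in unary, followed by a separator. -/
def encNum (m a : ℕ) : List (CSPSym m) :=
  List.replicate a CSPSym.one ++ [CSPSym.sep]

/-- A constraint is written as its relation symbol followed by the entries of its tuple. -/
def encConstraint {m : ℕ} {k : Fin m → ℕ} {n : ℕ} (c : (i : Fin m) × (Fin (k i) → Fin n)) :
    List (CSPSym m) :=
  CSPSym.rel c.1 :: (List.ofFn fun j => (c.2 j : ℕ)).flatMap (encNum m)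

/-- The code of an instance: the size of the domain followed by the constraints. For a fixed
signature its length is polynomially related to `|A| + |R₁| + ⋯ + |Rₘ|`: it is at least
`n` plus the number of constraints, and at most `n + 1` plus `1 + r (n + 1)` for every constraint,
where `r` is the largest arity. -/
def CSPInstance.encode {m : ℕ} {k : Fin m → ℕ} {D : Type} (A : CSPInstance k D) :
    List (CSPSym m) :=
  encNum m A.n ++ A.constraints.flatMap encConstraint

theorem encNum_append_inj {m a b : ℕ} {l l' : List (CSPSym m)}
    (h : encNum m a ++ l = encNum m b ++ l') : a = b ∧ l = l' := by
  induction a generalizing b with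
  | zero => cases b <;> simp_all [encNum, List.replicate_succ]
  | succ a ih =>
    cases b with
    | zero => simp [encNum, List.replicate_succ] at h
    | succ b =>
      have h' : encNum m a ++ l = encNum m b ++ l' := by
        simpa [encNum, List.replicate_succ] using h
      obtain ⟨rfl, rfl⟩ := ih h'
      exact ⟨rfl, rfl⟩

theorem flatMap_encNum_append_inj {m : ℕ} {u v : List ℕ} {l l' : List (CSPSym m)}
    (huv : u.length = v.length)
    (h : u.flatMap (encNum m) ++ l = v.flatMap (encNum m) ++ l') : u = v ∧ l = l' := by
  induction u generalizing v with
  | nil => cases v <;> simp_all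
  | cons a u ih =>
    cases v with
    | nil => simp at huv
    | cons b v =>
      simp only [List.flatMap_cons, List.append_assoc] at h
      obtain ⟨rfl, h2⟩ := encNum_append_inj h
      obtain ⟨rfl, rfl⟩ := ih (by simpa using huv) h2
      exact ⟨rfl, rfl⟩

theorem flatMap_encConstraint_injective {m : ℕ} {k : Fin m → ℕ} {n : ℕ} :
    Function.Injective (fun L : List ((i : Fin m) × (Fin (k i) → Fin n)) =>
      L.flatMap encConstraint) := by
  intro u v h
  induction u generalizing v with
  | nil => cases v <;> simp_all [encConstraint]
  | cons c u ih =>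
    cases v with
    | nil => simp [encConstraint] at h
    | cons d v =>
      obtain ⟨i, t⟩ := c
      obtain ⟨j, s⟩ := d
      simp only [List.flatMap_cons, encConstraint, List.cons_append, List.cons.injEq,
        CSPSym.rel.injEq] at h
      obtain ⟨rfl, h⟩ := h
      obtain ⟨hts, h⟩ := flatMap_encNum_append_inj (by simp) h
      have hts : t = s := by
        funext x
        exact Fin.ext (congrFun (List.ofFn_injective hts) x)
      rw [hts, ih h]

theorem CSPInstance.encode_injective {m : ℕ} {k : Fin m → ℕ} {D : Type} :
    Function.Injective (CSPInstance.encode : CSPInstance k D → List (CSPSym m)) := by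
  rintro ⟨n, hn, u, hu⟩ ⟨n', hn', v, hv⟩ h
  obtain ⟨h1, h2⟩ := encNum_append_inj h
  dsimp only at h1
  subst h1
  have h3 : u = v := flatMap_encConstraint_injective h2
  subst h3
  rfl

/-- Max-Sur-CSP(B): given a finite relational structure `A`, find a surjective function from the
domain of `A` to the domain of `B` that preserves as many constraints of `A` as possible. A function
is coded by the list of its values. -/
noncomputable def maxSurCSP {m : ℕ} {k : Fin m → ℕ} {D : Type} (B : RelStructure k D) :
    MaxProblem where
  Inst := CSPInstance k D
  Sol A := {h : Fin A.n → D // Function.Surjective h}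
  value A h := A.numSatisfied B h.1
  InstSym := CSPSym m
  SolSym := D
  encInst := CSPInstance.encode
  encSol _ h := List.ofFn h.1
  encInst_injective := CSPInstance.encode_injective
  encSol_injective _ _ _ h := Subtype.ext (List.ofFn_injective h)

/-! ### 2-monotone templates -/

/-- A Boolean relation is 2-monotone if it is defined by a formula `x₁ ∧ … ∧ x_p`, or
`¬y₁ ∧ … ∧ ¬y_q`, or `(x₁ ∧ … ∧ x_p) ∨ (¬y₁ ∧ … ∧ ¬y_q)` in its coordinates. -/
def IsTwoMonotone {r : ℕ} (R : Set (Fin r → Bool)) : Prop :=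
  ∃ P Q : Finset (Fin r),
    R = {t | ∀ j ∈ P, t j = true} ∨
    R = {t | ∀ j ∈ Q, t j = false} ∨
    R = {t | (∀ j ∈ P, t j = true) ∨ (∀ j ∈ Q, t j = false)}

/-- A relational structure on the Boolean domain is 2-monotone if all its relations are. -/
def RelStructure.IsTwoMonotone {m : ℕ} {k : Fin m → ℕ} (B : RelStructure k Bool) : Prop :=
  ∀ i, _root_.IsTwoMonotone (B i)

/-!
Finding a best surjective assignment for a 2-monotone template is a minimum cut problem, once one
variable `a₁` that is true and one variable `a₀` that is false are fixed. There are at most `n²`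
such pairs, each surjective assignment belongs to one of them, and the best assignment over all
pairs is optimal (`RawCSP.solve_spec`).

For a fixed pair, a constraint is satisfied if all its positive variables are true (its positive
side) or all its negative variables are false (its negative side); for an absent disjunct `a₀` is
taken as a positive variable or `a₁` as a negative one, which makes that side fail. The cut is
found as a minimum vertex cover of a bipartite graph. The left vertices are the positive sides
that do not contain `a₀`, and the right vertices are the negative sides that do not contain `a₁`.
An edge joins a positive side to a negative side with which it shares a variable, and the two sides
of the same constraint. The positive sides outside a cover can be satisfied together, by setting
exactly `a₁` and their variables to true, and a constraint is then violated only if each of its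
sides is in the cover or not a vertex. Conversely an assignment gives a cover, so minimum covers
give assignments with the fewest violated constraints (`MonotoneCut.violated_assign_le`).

A minimum vertex cover is computed by an auction. The left vertices bid for the right ones: as long
as possible, a vertex without an item takes a cheapest neighbour, whose price rises by one; its
former owner loses it. No bid is made on prices above `|R|`, so the auction ends. As there are only
`|R|` prices, some positive `g ≤ |R| + 1` is not a price. The left vertices with a neighbour cheaper
than `g`, together with the items dearer than `g`, form a cover. Each of them is matched by the
auction, and no edge of the matching is counted twice, so that the cover is minimum
(`Auction.exists_rightCover`).

Polynomial time on multi-stack machines is reached through a class of functions between types coded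
by binary trees (`PolyTime`). A function is in the class if a program fragment replaces the word of
its argument on top of a stack by the word of its value, in polynomial time. Fragments compose, so
the class is closed under composition, pairing, case distinction and iteration with polynomially
bounded states (`PolyTime.iterate`), from which the usual list operations follow and with them the
algorithm above and the recognition of instances and solutions (`RawCSP.isInst_iff`). A fragment
between a loop that reads the input and a loop that writes the output is a machine
(`PolyTime.polyTimeComputable`).
-/

/-! ### Program fragments for multi-stack machines -/

section Fragments

variable {K : Type} [DecidableEq K] {Γ : K → Type}

/-- The internal state of a machine assembled from fragments: for every stack, the symbol that was
last read from it. -/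
abbrev Reg (Γ : K → Type) : Type := (k : K) → Option (Γ k)

/-- A piece of machine code with one entry `start` and one exit. The code is parametrized by an
embedding of its labels into the labels of the whole machine and by the label of the exit. -/
structure Frag (Γ : K → Type) where
  Lab : Type
  fintypeLab : Fintype Lab
  start : Lab
  code : {L : Type} → (Lab → L) → L → Lab → TM2.Stmt Γ L (Reg Γ)

namespace Frag

attribute [instance] Frag.fintypeLab

/-- Started on the stacks `S`, the fragment reaches its exit with the stacks `S'` in at most `t`
steps, in every machine that contains it. -/
def Runs (F : Frag Γ) (S S' : (k : K) → List (Γ k)) (t : ℕ) : Prop :=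
  ∀ (L : Type) (M : L → TM2.Stmt Γ L (Reg Γ)) (e : F.Lab → L) (x : L),
    (∀ l, M (e l) = F.code e x l) → ∀ v, ∃ v' j, j ≤ t ∧
      (flip bind (TM2.step M))^[j] (some ⟨some (e F.start), v, S⟩) = some ⟨some x, v', S'⟩

/-- Do nothing. -/
def skip : Frag Γ where
  Lab := Unit
  fintypeLab := inferInstance
  start := ()
  code _ x _ := .goto fun _ => x

/-- Push the symbol `s` on the stack `k`. -/
def push (k : K) (s : Γ k) : Frag Γ where
  Lab := Unit
  fintypeLab := inferInstance
  start := ()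
  code _ x _ := .push k (fun _ => s) (.goto fun _ => x)

/-- Remove the top of the stack `k`. -/
def pop (k : K) : Frag Γ where
  Lab := Unit
  fintypeLab := inferInstance
  start := ()
  code _ x _ := .pop k (fun v _ => v) (.goto fun _ => x)

/-- Run `F`, then `G`. -/
def seq (F G : Frag Γ) : Frag Γ where
  Lab := F.Lab ⊕ G.Lab
  fintypeLab := inferInstance
  start := .inl F.start
  code e x
    | .inl l => F.code (e ∘ .inl) (e (.inr G.start)) l
    | .inr l => G.code (e ∘ .inr) x l

/-- Run the fragment that the top of the stack `k` selects. -/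
def case (k : K) [Fintype (Γ k)] (F : Option (Γ k) → Frag Γ) : Frag Γ where
  Lab := Option (Σ s, (F s).Lab)
  fintypeLab := inferInstance
  start := none
  code e x
    | none => .peek k (fun v s => Function.update v k s)
        (.goto fun v => e (some ⟨v k, (F (v k)).start⟩))
    | some ⟨s, l⟩ => (F s).code (fun l => e (some ⟨s, l⟩)) x l

/-- Run `F` as long as the top of the stack `k` satisfies `c`. -/
def loop (k : K) (c : Option (Γ k) → Bool) (F : Frag Γ) : Frag Γ where
  Lab := Option F.Lab
  fintypeLab := inferInstance
  start := none
  code e x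
    | none => .peek k (fun v s => Function.update v k s)
        (.goto fun v => bif c (v k) then e (some F.start) else x)
    | some l => F.code (e ∘ some) (e none) l

variable {F G : Frag Γ} {S S₁ S₂ : (k : K) → List (Γ k)} {t t₁ t₂ : ℕ}

theorem Runs.mono (h : F.Runs S S₁ t₁) (ht : t₁ ≤ t₂) : F.Runs S S₁ t₂ := fun L M e x hM v =>
  let ⟨v', j, hj, h'⟩ := h L M e x hM v
  ⟨v', j, hj.trans ht, h'⟩

theorem step_iterate_one {L : Type} {M : L → TM2.Stmt Γ L (Reg Γ)} {l : L} {q} (h : M l = q)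
    (v : Reg Γ) (S : (k : K) → List (Γ k)) :
    (flip bind (TM2.step M))^[1] (some ⟨some l, v, S⟩) = some (TM2.stepAux q v S) := by
  subst h; rfl

theorem runs_skip : (skip : Frag Γ).Runs S S 1 := fun _ _ _ _ hM v =>
  ⟨v, 1, le_rfl, step_iterate_one (hM ()) v S⟩

theorem runs_push (k : K) (s : Γ k) :
    (push k s).Runs S (Function.update S k (s :: S k)) 1 := fun _ _ _ _ hM v =>
  ⟨v, 1, le_rfl, step_iterate_one (hM ()) v S⟩

theorem runs_pop (k : K) :
    (pop k : Frag Γ).Runs S (Function.update S k (S k).tail) 1 := fun _ _ _ _ hM v =>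
  ⟨v, 1, le_rfl, step_iterate_one (hM ()) v S⟩

theorem Runs.seq (hF : F.Runs S S₁ t₁) (hG : G.Runs S₁ S₂ t₂) :
    (F.seq G).Runs S S₂ (t₁ + t₂) := by
  intro L M e x hM v
  obtain ⟨v₁, j₁, hj₁, h₁⟩ := hF L M (e ∘ .inl) (e (.inr G.start)) (fun l => hM (.inl l)) v
  obtain ⟨v₂, j₂, hj₂, h₂⟩ := hG L M (e ∘ .inr) x (fun l => hM (.inr l)) v₁
  refine ⟨v₂, j₂ + j₁, by omega, ?_⟩
  rw [Function.iterate_add_apply]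
  exact (congrArg _ h₁).trans h₂

theorem Runs.case {k : K} [Fintype (Γ k)] {F : Option (Γ k) → Frag Γ}
    (h : (F (S k).head?).Runs S S₁ t) : (case k F).Runs S S₁ (t + 1) := by
  intro L M e x hM v
  obtain ⟨v₁, j₁, hj₁, h₁⟩ := h L M (fun l => e (some ⟨_, l⟩)) x (fun l => hM (some ⟨_, l⟩))
    (Function.update v k (S k).head?)
  refine ⟨v₁, j₁ + 1, by omega, ?_⟩
  rw [Function.iterate_add_apply, ← h₁]
  refine congrArg _ ((step_iterate_one (hM none) v S).trans ?_)
  have hs := Function.update_self k (S k).head? v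
  exact congrArg (fun s => some (TM2.Cfg.mk (some (e (show Option (Σ s, (F s).Lab) from
    some ⟨s, (F s).start⟩))) (Function.update v k (S k).head?) S)) hs

theorem runs_loop_of_not {k : K} {c : Option (Γ k) → Bool} (hc : c (S k).head? = false) :
    (loop k c F).Runs S S 1 := fun L M e x hM v =>
  ⟨Function.update v k (S k).head?, 1, le_rfl, by
    refine (step_iterate_one (hM none) v S).trans ?_
    simp [loop, hc]⟩

theorem Runs.loop {k : K} {c : Option (Γ k) → Bool} (hc : c (S k).head? = true)
    (hF : F.Runs S S₁ t₁) (hl : (loop k c F).Runs S₁ S₂ t₂) :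
    (loop k c F).Runs S S₂ (t₁ + t₂ + 1) := by
  intro L M e x hM v
  obtain ⟨v₁, j₁, hj₁, h₁⟩ := hF L M (e ∘ some) (e none) (fun l => hM (some l))
    (Function.update v k (S k).head?)
  obtain ⟨v₂, j₂, hj₂, h₂⟩ := hl L M e x hM v₁
  refine ⟨v₂, j₂ + (j₁ + 1), by omega, ?_⟩
  rw [Function.iterate_add_apply, Function.iterate_add_apply, ← h₂]
  refine congrArg _ (Eq.trans (congrArg _ ?_) h₁)
  refine (step_iterate_one (hM none) v S).trans ?_
  simp [Frag.loop, hc]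
  rfl

end Frag

end Fragments

/-! ### Binary trees on stacks -/

/-- Unlabelled binary trees, the universal data type of the programs below. -/
inductive BTree : Type
  | leaf : BTree
  | node (a b : BTree) : BTree

namespace BTree

/-- The preorder word of a tree. It is self-delimiting, so a tree can be read off the top of a
stack whatever lies below it. -/
def word : BTree → List Bool
  | leaf => [false]
  | node a b => true :: (a.word ++ b.word)

/-- The number of nodes and leaves, which is the length of the word. -/
def size : BTree → ℕ
  | leaf => 1
  | node a b => a.size + b.size + 1

theorem size_pos (x : BTree) : 0 < x.size := by cases x <;> simp [size]

theorem length_word (x : BTree) : x.word.length = x.size := by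
  induction x with
  | leaf => rfl
  | node a b iha ihb => simp [word, size, iha, ihb]

end BTree

/-- The stacks of the machines: input, output, two stacks `side b` for trees (`side false` holds
the current tree, `side true` the saved ones), and two scratch stacks that are empty between
operations. -/
inductive Stk : Type
  | inp | out | side (b : Bool) | tmp | cnt
  deriving DecidableEq, Fintype

/-- The stack alphabets. -/
@[reducible] def StkSym (Γ : Type) : Stk → Type
  | .inp => Γ
  | .out => Bool
  | .side _ => Bool
  | .tmp => Bool
  | .cnt => Bool

instance {Γ : Type} [Fintype Γ] : (k : Stk) → Fintype (StkSym Γ k)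
  | .inp => inferInstanceAs (Fintype Γ)
  | .out => inferInstanceAs (Fintype Bool)
  | .side _ => inferInstanceAs (Fintype Bool)
  | .tmp => inferInstanceAs (Fintype Bool)
  | .cnt => inferInstanceAs (Fintype Bool)

section Store

variable {Γ : Type}

/-- The stacks with the given contents. -/
def store (i : List Γ) (o : List Bool) (s : Bool → List Bool) (t c : List Bool) :
    (k : Stk) → List (StkSym Γ k)
  | .inp => i
  | .out => o
  | .side b => s b
  | .tmp => t
  | .cnt => c

variable (i : List Γ) (o : List Bool) (s : Bool → List Bool) (t c : List Bool)

@[simp] theorem store_inp : store i o s t c .inp = i := rfl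
@[simp] theorem store_out : store i o s t c .out = o := rfl
@[simp] theorem store_side (b : Bool) : store i o s t c (.side b) = s b := rfl
@[simp] theorem store_tmp : store i o s t c .tmp = t := rfl
@[simp] theorem store_cnt : store i o s t c .cnt = c := rfl

@[simp] theorem update_store_inp (l : List Γ) :
    Function.update (store i o s t c) .inp l = store l o s t c := by
  funext k; cases k <;> rfl

@[simp] theorem update_store_out (l : List Bool) :
    Function.update (store i o s t c) .out l = store i l s t c := by
  funext k; cases k <;> rfl

@[simp] theorem update_store_side (b : Bool) (l : List Bool) :
    Function.update (store i o s t c) (.side b) l = store i o (Function.update s b l) t c := by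
  funext k
  cases k with
  | side b' => cases b <;> cases b' <;> rfl
  | _ => rfl

@[simp] theorem update_store_tmp (l : List Bool) :
    Function.update (store i o s t c) .tmp l = store i o s l c := by
  funext k; cases k <;> rfl

@[simp] theorem update_store_cnt (l : List Bool) :
    Function.update (store i o s t c) .cnt l = store i o s t l := by
  funext k; cases k <;> rfl

end Store

/-- Contents `d` and `h` of the two tree stacks. -/
def sides (d h : List Bool) : Bool → List Bool
  | false => d
  | true => h

@[simp] theorem sides_false (d h : List Bool) : sides d h false = d := rfl
@[simp] theorem sides_true (d h : List Bool) : sides d h true = h := rfl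

@[simp] theorem update_sides_false (d h l : List Bool) :
    Function.update (sides d h) false l = sides l h := by
  funext b; cases b <;> rfl

@[simp] theorem update_sides_true (d h l : List Bool) :
    Function.update (sides d h) true l = sides d l := by
  funext b; cases b <;> rfl

namespace Frag

variable {Γ : Type} {i : List Γ} {o : List Bool}

/-- Move the stack `tmp` to `side b`, which reverses it. -/
def reload (Γ : Type) (b : Bool) : Frag (StkSym Γ) :=
  loop .tmp Option.isSome <| case .tmp fun
    | some x => (pop .tmp).seq (push (.side b) x)
    | none => skip

/-- Move the stack `tmp` to both tree stacks. -/
def reloadBoth (Γ : Type) : Frag (StkSym Γ) :=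
  loop .tmp Option.isSome <| case .tmp fun
    | some x => (pop .tmp).seq ((push (.side false) x).seq (push (.side true) x))
    | none => skip

/-- Empty the stack `tmp`. -/
def clear (Γ : Type) : Frag (StkSym Γ) := loop .tmp Option.isSome (pop .tmp)

/-- Move the words of as many trees as there are symbols on `cnt` from `side b` to `tmp`. -/
def unloadLoop (Γ : Type) (b : Bool) : Frag (StkSym Γ) :=
  loop .cnt Option.isSome <| case (.side b) fun
    | some true => (pop (.side b)).seq ((push .tmp true).seq (push .cnt true))
    | some false => (pop (.side b)).seq ((push .tmp false).seq (pop .cnt))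
    | none => skip

/-- Move the word of the top tree from `side b` to `tmp`, which reverses it. -/
def unload (Γ : Type) (b : Bool) : Frag (StkSym Γ) := (push .cnt true).seq (unloadLoop Γ b)

theorem runs_reload (b : Bool) (s : Bool → List Bool) (t c : List Bool) :
    (reload Γ b).Runs (store i o s t c)
      (store i o (Function.update s b (t.reverse ++ s b)) [] c) (4 * t.length + 1) := by
  induction t generalizing s with
  | nil =>
    simp only [List.reverse_nil, List.nil_append, Function.update_eq_self, List.length_nil]
    exact runs_loop_of_not rfl
  | cons x t ih =>
    have h := ih (Function.update s b (x :: s b))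
    simp only [Function.update_idem, Function.update_self] at h
    have hF := (runs_pop (S := store i o s (x :: t) c) .tmp).seq (runs_push (.side b) x)
    simp only [update_store_tmp, update_store_side, store_tmp, store_side, List.tail_cons] at hF
    simpa using! (Runs.loop rfl hF.case h).mono (by simp; omega)

theorem runs_reloadBoth (d h t c : List Bool) :
    (reloadBoth Γ).Runs (store i o (sides d h) t c)
      (store i o (sides (t.reverse ++ d) (t.reverse ++ h)) [] c) (5 * t.length + 1) := by
  induction t generalizing d h with
  | nil =>
    simp only [List.reverse_nil, List.nil_append, List.length_nil]
    exact runs_loop_of_not rfl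
  | cons x t ih =>
    have hl := ih (x :: d) (x :: h)
    have hF := (runs_pop (S := store i o (sides d h) (x :: t) c) .tmp).seq
      ((runs_push (.side false) x).seq (runs_push (.side true) x))
    simp only [update_store_tmp, update_store_side, store_tmp, store_side, List.tail_cons,
      update_sides_false, update_sides_true, sides_false, sides_true] at hF
    simpa using! (Runs.loop rfl hF.case hl).mono (by simp; omega)

theorem runs_clear (s : Bool → List Bool) (t c : List Bool) :
    (clear Γ).Runs (store i o s t c) (store i o s [] c) (2 * t.length + 1) := by
  induction t with
  | nil =>
    exact runs_loop_of_not rfl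
  | cons x t ih =>
    have hF := runs_pop (S := store i o s (x :: t) c) .tmp
    simp only [update_store_tmp, store_tmp, List.tail_cons] at hF
    exact (Runs.loop rfl hF ih).mono (by simp; omega)

theorem runs_unloadLoop (b : Bool) (x : BTree) {s : Bool → List Bool} {r t c : List Bool}
    {S : (k : Stk) → List (StkSym Γ k)} {n : ℕ}
    (h : (unloadLoop Γ b).Runs (store i o (Function.update s b r) (x.word.reverse ++ t) c) S n) :
    (unloadLoop Γ b).Runs (store i o (Function.update s b (x.word ++ r)) t (true :: c)) S
      (5 * x.size + n) := by
  have hread : ∀ a r', (store i o (Function.update s b (a :: r')) t (true :: c)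
      (.side b)).head? = some a := by simp
  induction x generalizing s r t c n with
  | leaf =>
    have hF := (runs_pop (S := store i o (Function.update s b (false :: r)) t (true :: c))
      (.side b)).seq ((runs_push .tmp false).seq (runs_pop .cnt))
    simp only [update_store_tmp, update_store_side, update_store_cnt, store_tmp, store_side,
      store_cnt, List.tail_cons, Function.update_idem, Function.update_self] at hF
    refine (Runs.loop rfl (Runs.case ?_) h).mono
      (t₁ := 3 + 1 + n + 1) (by simp only [BTree.size]; omega)
    simp only [BTree.word, List.cons_append, List.nil_append, hread]
    exact hF
  | node x y ihx ihy =>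
    have hF := (runs_pop (S := store i o (Function.update s b (true :: (x.word ++ (y.word ++ r))))
      t (true :: c)) (.side b)).seq ((runs_push .tmp true).seq (runs_push .cnt true))
    simp only [update_store_tmp, update_store_side, update_store_cnt, store_tmp, store_side,
      store_cnt, List.tail_cons, Function.update_idem, Function.update_self] at hF
    have h' := ihx (s := s) (t := true :: t) (c := true :: c)
      (ihy (by simpa [BTree.word] using h) (by simp)) (by simp)
    refine (Runs.loop rfl (Runs.case ?_) h').mono
      (t₁ := 3 + 1 + (5 * x.size + (5 * y.size + n)) + 1) (by simp only [BTree.size]; omega)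
    simp only [BTree.word, List.cons_append, List.append_assoc, hread]
    exact hF

theorem runs_unload (b : Bool) (x : BTree) (s : Bool → List Bool) (r t : List Bool) :
    (unload Γ b).Runs (store i o (Function.update s b (x.word ++ r)) t [])
      (store i o (Function.update s b r) (x.word.reverse ++ t) []) (5 * x.size + 2) := by
  have h := runs_push (S := store i o (Function.update s b (x.word ++ r)) t []) .cnt true
  simp only [update_store_cnt, store_cnt] at h
  exact (h.seq (runs_unloadLoop b x (runs_loop_of_not rfl))).mono (by omega)

/-- Copy the top tree of `side false` to `side true`. -/
def copyTree (Γ : Type) : Frag (StkSym Γ) := (unload Γ false).seq (reloadBoth Γ)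

/-- Move the top tree of `side b` to the other tree stack. -/
def moveTree (Γ : Type) (b : Bool) : Frag (StkSym Γ) := (unload Γ b).seq (reload Γ !b)

/-- Remove the top tree of `side false`. -/
def dropTree (Γ : Type) : Frag (StkSym Γ) := (unload Γ false).seq (clear Γ)

variable (x : BTree) (d h : List Bool)

theorem runs_copyTree :
    (copyTree Γ).Runs (store i o (sides (x.word ++ d) h) [] [])
      (store i o (sides (x.word ++ d) (x.word ++ h)) [] []) (10 * x.size + 3) := by
  have h₁ := runs_unload (i := i) (o := o) false x (sides d h) d []
  have h₂ := runs_reloadBoth (i := i) (o := o) d h x.word.reverse []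
  simp only [update_sides_false, List.append_nil, List.reverse_reverse, List.length_reverse,
    x.length_word] at h₁ h₂
  exact (h₁.seq h₂).mono (by omega)

theorem runs_moveTree_false :
    (moveTree Γ false).Runs (store i o (sides (x.word ++ d) h) [] [])
      (store i o (sides d (x.word ++ h)) [] []) (9 * x.size + 3) := by
  have h₁ := runs_unload (i := i) (o := o) false x (sides d h) d []
  have h₂ := runs_reload (i := i) (o := o) true (sides d h) x.word.reverse []
  simp only [update_sides_false, update_sides_true, List.append_nil, List.reverse_reverse,
    List.length_reverse, sides_true, x.length_word] at h₁ h₂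
  exact (h₁.seq h₂).mono (by omega)

theorem runs_moveTree_true :
    (moveTree Γ true).Runs (store i o (sides d (x.word ++ h)) [] [])
      (store i o (sides (x.word ++ d) h) [] []) (9 * x.size + 3) := by
  have h₁ := runs_unload (i := i) (o := o) true x (sides d h) h []
  have h₂ := runs_reload (i := i) (o := o) false (sides d h) x.word.reverse []
  simp only [update_sides_false, update_sides_true, List.append_nil, List.reverse_reverse,
    List.length_reverse, sides_false, x.length_word] at h₁ h₂
  exact (h₁.seq h₂).mono (by omega)

theorem runs_dropTree :
    (dropTree Γ).Runs (store i o (sides (x.word ++ d) h) [] [])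
      (store i o (sides d h) [] []) (7 * x.size + 3) := by
  have h₁ := runs_unload (i := i) (o := o) false x (sides d h) d []
  have h₂ := runs_clear (i := i) (o := o) (sides d h) x.word.reverse []
  simp only [update_sides_false, List.append_nil, List.length_reverse, x.length_word] at h₁ h₂
  exact (h₁.seq h₂).mono (by omega)

theorem runs_pop_side (b : Bool) :
    (pop (.side false)).Runs (store i o (sides (b :: d) h) [] [])
      (store i o (sides d h) [] []) 1 := by
  simpa using runs_pop (S := store i o (sides (b :: d) h) [] []) (.side false)

theorem runs_push_side (b : Bool) :
    (push (.side false) b).Runs (store i o (sides d h) [] [])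
      (store i o (sides (b :: d) h) [] []) 1 := by
  simpa using runs_push (S := store i o (sides d h) [] []) (.side false) b

/-- Push a word on `side false`. -/
def pushWord (Γ : Type) (w : List Bool) : Frag (StkSym Γ) :=
  w.foldr (fun b F => F.seq (push (.side false) b)) skip

theorem runs_pushWord (w : List Bool) :
    (pushWord Γ w).Runs (store i o (sides d h) [] [])
      (store i o (sides (w ++ d) h) [] []) (w.length + 1) := by
  induction w with
  | nil => exact runs_skip
  | cons b w ih => exact (ih.seq (runs_push_side (w ++ d) h b)).mono (by simp)

end Frag

/-! ### Polynomial-time functions on types coded by trees -/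

theorem Polynomial.eval_mono_nat (p : Polynomial ℕ) {a b : ℕ} (h : a ≤ b) :
    p.eval a ≤ p.eval b := by
  simp only [Polynomial.eval_eq_sum, Polynomial.sum]
  gcongr

/-- A coding of a type by binary trees. -/
class TreeCode (α : Type) where
  toTree : α → BTree

open TreeCode (toTree)

/-- The size of the tree that codes `a`. -/
def codeSize {α : Type} [TreeCode α] (a : α) : ℕ := (toTree a).size

theorem codeSize_pos {α : Type} [TreeCode α] (a : α) : 0 < codeSize a := BTree.size_pos _

theorem length_toTree_word {α : Type} [TreeCode α] (a : α) :
    (toTree a).word.length = codeSize a := BTree.length_word _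

instance : TreeCode Unit := ⟨fun _ => .leaf⟩

/-- `false` is coded by a leaf, so that `PolyTime.branch` tests Booleans. -/
instance : TreeCode Bool := ⟨fun b => bif b then .node .leaf .leaf else .leaf⟩

/-- Natural numbers are coded in unary. -/
instance : TreeCode ℕ := ⟨fun n => n.rec .leaf fun _ x => .node .leaf x⟩

instance {α β : Type} [TreeCode α] [TreeCode β] : TreeCode (α × β) :=
  ⟨fun p => .node (toTree p.1) (toTree p.2)⟩

/-- Lists are coded by right combs; a nonempty list has the same code as the pair of its head and
its tail. -/
instance {α : Type} [TreeCode α] : TreeCode (List α) :=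
  ⟨List.foldr (fun a x => .node (toTree a) x) .leaf⟩

/-- The stacks between operations: words of trees on the two tree stacks, and nothing on the
scratch stacks. -/
def treeStore {Γ : Type} (i : List Γ) (o d h : List Bool) : (k : Stk) → List (StkSym Γ k) :=
  store i o (sides d h) [] []

/-- The fragment `P` computes the function `f` in time `p`: it replaces the code of `a` on top of
`side false` by the code of `f a`, whatever the other stacks and the rest of this stack hold. The
polynomial `p` also bounds the size of the code of `f a`. -/
def Frag.Computes {α β Γ : Type} [TreeCode α] [TreeCode β] (P : Frag (StkSym Γ))
    (p : Polynomial ℕ) (f : α → β) : Prop :=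
  ∀ a, codeSize (f a) ≤ p.eval (codeSize a) ∧
    ∀ i o d h, P.Runs (treeStore i o ((toTree a).word ++ d) h)
      (treeStore i o ((toTree (f a)).word ++ d) h) (p.eval (codeSize a))

/-- Functions computed by program fragments in polynomial time. Quantifying over the input alphabet
`Γ` of the machines makes the notion independent of it. -/
def PolyTime {α β : Type} [TreeCode α] [TreeCode β] (f : α → β) : Prop :=
  ∀ (Γ : Type) [Fintype Γ], ∃ (P : Frag (StkSym Γ)) (p : Polynomial ℕ), P.Computes p f

namespace PolyTime

open Frag

variable {α β γ δ α₁ α₂ : Type} [TreeCode α] [TreeCode β] [TreeCode γ] [TreeCode δ]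
  [TreeCode α₁] [TreeCode α₂]

theorem exists_codeSize_le {f : α → β} (hf : PolyTime f) :
    ∃ p : Polynomial ℕ, ∀ a, codeSize (f a) ≤ p.eval (codeSize a) :=
  let ⟨_, p, h⟩ := hf Unit
  ⟨p, fun a => (h a).1⟩

/-- Only the codes of the arguments and values of a function matter. -/
theorem of_code {f : α → β} {f' : α₁ → α₂} (hf : PolyTime f)
    (h : ∀ a', ∃ a, toTree a = toTree a' ∧ toTree (f a) = toTree (f' a')) : PolyTime f' := by
  intro Γ _
  obtain ⟨P, p, hP⟩ := hf Γ
  refine ⟨P, p, fun a' => ?_⟩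
  obtain ⟨a, h₁, h₂⟩ := h a'
  have := hP a
  simp only [codeSize] at this ⊢
  rwa [h₁, h₂] at this

theorem id : PolyTime fun a : α => a := fun Γ _ =>
  ⟨skip, Polynomial.X + 1, fun x => ⟨by simp, fun i o d h => runs_skip.mono (by simp)⟩⟩

theorem comp {f : β → γ} {g : α → β} (hf : PolyTime f) (hg : PolyTime g) :
    PolyTime fun a => f (g a) := by
  intro Γ _
  obtain ⟨P, p, hP⟩ := hf Γ
  obtain ⟨Q, q, hQ⟩ := hg Γ
  refine ⟨Q.seq P, q + p.comp q, fun a => ?_⟩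
  have h₁ := p.eval_mono_nat (hQ a).1
  simp only [Polynomial.eval_add, Polynomial.eval_comp]
  exact ⟨by have := (hP (g a)).1; omega, fun i o d h =>
    (((hQ a).2 i o d h).seq ((hP (g a)).2 i o d h)).mono (by omega)⟩

theorem const (b : β) : PolyTime fun _ : α => b := fun Γ _ =>
  ⟨(dropTree Γ).seq (pushWord Γ (toTree b).word), 7 * Polynomial.X + Polynomial.C (codeSize b + 4),
    fun a => ⟨by simp; omega, fun i o d h =>
      ((runs_dropTree (toTree a) d h).seq (runs_pushWord d h (toTree b).word)).mono (by
        simp [length_toTree_word, codeSize]; omega)⟩⟩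

theorem pair {f : α → β} {g : α → γ} (hf : PolyTime f) (hg : PolyTime g) :
    PolyTime fun a => (f a, g a) := by
  intro Γ _
  obtain ⟨P, p, hP⟩ := hf Γ
  obtain ⟨Q, q, hQ⟩ := hg Γ
  refine ⟨((copyTree Γ).seq Q).seq ((moveTree Γ true).seq (P.seq (push (.side false) true))),
    p + q + 19 * Polynomial.X + 7, fun a => ⟨?_, fun i o d h => ?_⟩⟩
  · have h₁ := (hP a).1
    have h₂ := (hQ a).1
    simp only [codeSize, toTree, BTree.size] at h₁ h₂ ⊢
    simp
    omega
  · have h₁ := runs_copyTree (i := i) (o := o) (toTree a) d h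
    have h₂ := (hQ a).2 i o d ((toTree a).word ++ h)
    have h₃ := runs_moveTree_true (i := i) (o := o) (toTree a) ((toTree (g a)).word ++ d) h
    have h₄ := (hP a).2 i o ((toTree (g a)).word ++ d) h
    have h₅ := runs_push_side (i := i) (o := o)
      ((toTree (f a)).word ++ ((toTree (g a)).word ++ d)) h true
    have := (h₁.seq h₂).seq (h₃.seq (h₄.seq h₅))
    have hc : (toTree (f a, g a)).word ++ d =
      true :: ((toTree (f a)).word ++ ((toTree (g a)).word ++ d)) := by simp [toTree, BTree.word]
    rw [hc]
    exact this.mono (by simp [codeSize]; omega)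

theorem prodFst : PolyTime (Prod.fst : α × β → α) := fun Γ _ =>
  ⟨(pop (.side false)).seq ((moveTree Γ false).seq ((dropTree Γ).seq (moveTree Γ true))),
    18 * Polynomial.X + 10, fun ⟨a, b⟩ => by
    have hs : codeSize (a, b) = codeSize a + codeSize b + 1 := rfl
    refine ⟨by simp; omega, fun i o d h => ?_⟩
    have := (runs_pop_side (i := i) (o := o) ((toTree a).word ++ ((toTree b).word ++ d)) h true).seq
      ((runs_moveTree_false (toTree a) ((toTree b).word ++ d) h).seq
        ((runs_dropTree (toTree b) d ((toTree a).word ++ h)).seq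
          (runs_moveTree_true (toTree a) d h)))
    have hc : (toTree (a, b)).word ++ d = true :: ((toTree a).word ++ ((toTree b).word ++ d)) := by
      simp [toTree, BTree.word]
    rw [hc]
    refine this.mono ?_
    simp only [codeSize] at hs ⊢
    simp
    omega⟩

theorem prodSnd : PolyTime (Prod.snd : α × β → β) := fun Γ _ =>
  ⟨(pop (.side false)).seq (dropTree Γ), 7 * Polynomial.X + 4, fun ⟨a, b⟩ => by
    have hs : codeSize (a, b) = codeSize a + codeSize b + 1 := rfl
    refine ⟨by simp; omega, fun i o d h => ?_⟩
    have := (runs_pop_side (i := i) (o := o) ((toTree a).word ++ ((toTree b).word ++ d)) h true).seq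
      (runs_dropTree (toTree a) ((toTree b).word ++ d) h)
    have hc : (toTree (a, b)).word ++ d = true :: ((toTree a).word ++ ((toTree b).word ++ d)) := by
      simp [toTree, BTree.word]
    rw [hc]
    refine this.mono ?_
    simp only [codeSize] at hs ⊢
    simp
    omega⟩

/-- Case distinction on whether the code of `c a` is a leaf. The functions of the two cases may take
arguments of other types, with the same codes. -/
theorem branch {c : α → δ} {f₁ : α₁ → β} {f₂ : α₂ → β} {f : α → β} (hc : PolyTime c)
    (hf₁ : PolyTime f₁) (hf₂ : PolyTime f₂)
    (h₁ : ∀ a, toTree (c a) = .leaf → ∃ a₁, toTree a₁ = toTree a ∧ f₁ a₁ = f a)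
    (h₂ : ∀ a, toTree (c a) ≠ .leaf → ∃ a₂, toTree a₂ = toTree a ∧ f₂ a₂ = f a) : PolyTime f := by
  intro Γ _
  obtain ⟨R, r, hR⟩ := (hc.pair id) Γ
  obtain ⟨P, p, hP⟩ := hf₁ Γ
  obtain ⟨Q, q, hQ⟩ := hf₂ Γ
  refine ⟨R.seq ((pop (.side false)).seq (case (.side false) fun
    | some true => (dropTree Γ).seq Q
    | _ => (dropTree Γ).seq P)), 8 * r + p + q + 5, fun a => ?_⟩
  have hs : codeSize (c a, a) = codeSize (c a) + codeSize a + 1 := rfl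
  have ht (d : List Bool) : (toTree (c a, a)).word ++ d =
      true :: ((toTree (c a)).word ++ ((toTree a).word ++ d)) := by simp [toTree, BTree.word]
  have hRs : codeSize (c a, a) ≤ _ := (hR a).1
  have hdrop (i : List Γ) (o d h) := (runs_pop_side (i := i) (o := o)
    ((toTree (c a)).word ++ ((toTree a).word ++ d)) h true)
  rcases hx : toTree (c a) with _ | ⟨u, v⟩
  · obtain ⟨a₁, ha, hfa⟩ := h₁ a hx
    have hsz : codeSize a₁ = codeSize a := congrArg BTree.size ha
    have hPa := hP a₁
    rw [hfa, hsz, ha] at hPa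
    refine ⟨by simp; omega, fun i o d h => ?_⟩
    have hrun := ((hR a).2 i o d h)
    rw [ht] at hrun
    refine ((hrun.seq ((hdrop i o d h).seq (Runs.case ?_)))).mono
      (t₁ := r.eval (codeSize a) + (1 + (7 * codeSize (c a) + 3 + p.eval (codeSize a) + 1))) ?_
    · have hcs : codeSize (c a) = _ := congrArg BTree.size hx
      rw [hx, hcs]
      have := (runs_dropTree (i := i) (o := o) (toTree (c a)) ((toTree a).word ++ d) h).seq
        (hPa.2 i o d h)
      rw [hx] at this
      exact this
    · simp
      omega
  · obtain ⟨a₂, ha, hfa⟩ := h₂ a (by simp [hx])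
    have hsz : codeSize a₂ = codeSize a := congrArg BTree.size ha
    have hQa := hQ a₂
    rw [hfa, hsz, ha] at hQa
    refine ⟨by simp; omega, fun i o d h => ?_⟩
    have hrun := ((hR a).2 i o d h)
    rw [ht] at hrun
    refine ((hrun.seq ((hdrop i o d h).seq (Runs.case ?_)))).mono
      (t₁ := r.eval (codeSize a) + (1 + (7 * codeSize (c a) + 3 + q.eval (codeSize a) + 1))) ?_
    · have hcs : codeSize (c a) = _ := congrArg BTree.size hx
      rw [hx, hcs]
      have := (runs_dropTree (i := i) (o := o) (toTree (c a)) ((toTree a).word ++ d) h).seq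
        (hQa.2 i o d h)
      rw [hx] at this
      exact this
    · simp
      omega

/-- Iteration of `g` until the left subtree of the code of the state is a leaf, in a polynomial
number of rounds and with states of polynomial size. -/
theorem iterate {init : α → γ} {g : γ → γ} {f : α → β} (hinit : PolyTime init) (hg : PolyTime g)
    (N : α → ℕ) (hstep : ∀ a, ∀ j < N a, ∃ u v w, toTree (g^[j] (init a)) = .node (.node u v) w)
    (hend : ∀ a, toTree (g^[N a] (init a)) = .node .leaf (toTree (f a)))
    (hb : ∃ b : Polynomial ℕ, ∀ a, N a ≤ b.eval (codeSize a) ∧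
      ∀ j ≤ N a, codeSize (g^[j] (init a)) ≤ b.eval (codeSize a)) : PolyTime f := by
  intro Γ _
  obtain ⟨b, hb⟩ := hb
  obtain ⟨R, r, hR⟩ := hinit Γ
  obtain ⟨P, p, hP⟩ := hg Γ
  let body : Frag (StkSym Γ) := (push (.side false) true).seq (P.seq (pop (.side false)))
  let L : Frag (StkSym Γ) := loop (.side false) (· == some true) body
  -- The loop starts and ends with the leading symbol of the state removed, so that its head tests
  -- the left subtree.
  have hloop (a : α) (i o d h) (n j : ℕ) (hj : j + n = N a) : ∀ w,
      (toTree (g^[j] (init a))).word = true :: w →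
      L.Runs (treeStore i o (w ++ d) h) (treeStore i o (false :: ((toTree (f a)).word ++ d)) h)
        (n * (p.eval (b.eval (codeSize a)) + 3) + 1) := by
    induction n generalizing j with
    | zero =>
      intro w hw
      obtain rfl : j = N a := by omega
      rw [hend] at hw
      obtain rfl : false :: (toTree (f a)).word = w := by simpa [BTree.word] using hw
      exact (runs_loop_of_not rfl).mono (by omega)
    | succ n ih =>
      intro w hw
      obtain ⟨u, v, x, hu⟩ := hstep a j (by omega)
      have hne : ∃ w', (toTree (g^[j + 1] (init a))).word = true :: w' := by
        rcases n.eq_zero_or_pos with rfl | hn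
        · rw [show j + 1 = N a by omega, hend]
          exact ⟨_, rfl⟩
        · obtain ⟨u, v, x, h⟩ := hstep a (j + 1) (by omega)
          rw [h]
          exact ⟨_, rfl⟩
      obtain ⟨w', hw'⟩ := hne
      have hP' := (hP (g^[j] (init a))).2 i o d h
      rw [← Function.iterate_succ_apply' g, hw', hw] at hP'
      have hbody : body.Runs _ _ _ := (runs_push_side (i := i) (o := o) (w ++ d) h true).seq
        (hP'.seq (runs_pop_side (w' ++ d) h true))
      have hpj := p.eval_mono_nat ((hb a).2 j (by omega))
      rw [hu] at hw
      obtain rfl : true :: _ = w := (List.cons.inj hw).2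
      refine (Runs.loop (k := .side false) rfl hbody (ih (j + 1) (by omega) w' hw')).mono ?_
      rw [add_mul]
      omega
  refine ⟨R.seq ((pop (.side false)).seq (L.seq (pop (.side false)))),
    r + b + b * (p.comp b + 3) + 3, fun a => ⟨?_, fun i o d h => ?_⟩⟩
  · have := (hb a).2 _ le_rfl
    simp only [codeSize, hend, BTree.size] at this ⊢
    simp
    omega
  · have hne : ∃ w, (toTree (g^[0] (init a))).word = true :: w := by
      rcases (N a).eq_zero_or_pos with hn | hn
      · rw [← hn, hend]
        exact ⟨_, rfl⟩
      · obtain ⟨u, v, x, h⟩ := hstep a 0 hn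
        rw [h]
        exact ⟨_, rfl⟩
    obtain ⟨w, hw⟩ := hne
    have hR' := (hR a).2 i o d h
    rw [show toTree (init a) = toTree (g^[0] (init a)) from rfl, hw] at hR'
    refine (hR'.seq ((runs_pop_side (w ++ d) h true).seq
      ((hloop a i o d h (N a) 0 (zero_add _) w hw).seq
        (runs_pop_side ((toTree (f a)).word ++ d) h false)))).mono ?_
    have := Nat.mul_le_mul_right (p.eval (b.eval (codeSize a)) + 3) (hb a).1
    simp
    omega

end PolyTime

/-! ### Machines for polynomial-time functions -/

section CodeSize

variable {α : Type} [TreeCode α]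

@[simp] theorem codeSize_nil : codeSize ([] : List α) = 1 := rfl

@[simp] theorem codeSize_cons (a : α) (l : List α) :
    codeSize (a :: l) = codeSize a + codeSize l + 1 := rfl

theorem length_le_codeSize (l : List α) : l.length ≤ codeSize l := by
  induction l with
  | nil => simp
  | cons a l ih => simp; omega

theorem codeSize_append (l l' : List α) :
    codeSize (l ++ l') + 1 = codeSize l + codeSize l' := by
  induction l with
  | nil => simp; omega
  | cons a l ih => simp; omega

theorem codeSize_reverse (l : List α) : codeSize l.reverse = codeSize l := by
  induction l with
  | nil => rfl
  | cons a l ih =>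
    have := codeSize_append l.reverse [a]
    simp at this ⊢
    omega

theorem codeSize_le_of_forall {l : List α} {m : ℕ} (h : ∀ a ∈ l, codeSize a ≤ m) :
    codeSize l ≤ l.length * (m + 1) + 1 := by
  induction l with
  | nil => simp
  | cons a l ih =>
    have h₁ := ih fun b hb => h b (List.mem_cons_of_mem _ hb)
    have h₂ := h a List.mem_cons_self
    simp only [codeSize_cons, List.length_cons, add_mul] at h₁ ⊢
    omega

end CodeSize

namespace Frag

variable {Γ : Type}

/-- Consume the input, pushing the code of every symbol on a list. -/
def readInput [Fintype Γ] (sym : Γ → ℕ) : Frag (StkSym Γ) :=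
  loop .inp Option.isSome <| case .inp fun
    | some s => (pop .inp).seq
        ((pushWord Γ (toTree (sym s)).word).seq (push (.side false) true))
    | none => skip

/-- Consume a list of Booleans, pushing its entries on the output stack. The symbol of the empty
list at its end is left. -/
def writeOutput (Γ : Type) : Frag (StkSym Γ) :=
  loop (.side false) (· == some true) <| (pop (.side false)).seq <| case (.side false) fun
    | some true => (pop (.side false)).seq
        ((pop (.side false)).seq ((pop (.side false)).seq (push .out true)))
    | _ => (pop (.side false)).seq (push .out false)

theorem runs_readInput [Fintype Γ] {sym : Γ → ℕ} {m : ℕ} (hm : ∀ s, codeSize (sym s) ≤ m)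
    (w : List Γ) (l : List ℕ) (o d h : List Bool) :
    (readInput sym).Runs (treeStore w o ((toTree l).word ++ d) h)
      (treeStore [] o ((toTree ((w.map sym).reverse ++ l)).word ++ d) h)
      (w.length * (m + 5) + 1) := by
  induction w generalizing l with
  | nil => exact (runs_loop_of_not rfl).mono (by omega)
  | cons s w ih =>
    have h₁ := runs_pop (S := treeStore (s :: w) o ((toTree l).word ++ d) h) .inp
    simp only [treeStore, update_store_inp, store_inp, List.tail_cons] at h₁
    have h₂ := (h₁.seq ((runs_pushWord ((toTree l).word ++ d) h (toTree (sym s)).word).seq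
      (runs_push_side _ h true)))
    have hc : true :: ((toTree (sym s)).word ++ ((toTree l).word ++ d)) =
      (toTree (sym s :: l)).word ++ d := by simp [toTree, BTree.word]
    rw [hc] at h₂
    have h₃ := ih (sym s :: l)
    simp only [List.map_cons, List.reverse_cons, List.append_assoc, List.singleton_append]
    refine (Runs.loop rfl h₂.case h₃).mono ?_
    have := hm s
    rw [length_toTree_word, List.length_cons, add_mul]
    omega

theorem runs_push_out {i : List Γ} {o d h : List Bool} (b : Bool) :
    (push .out b).Runs (treeStore i o d h) (treeStore i (b :: o) d h) 1 := by
  simpa [treeStore] using! runs_push (S := treeStore i o d h) .out b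

theorem runs_writeOutput (l : List Bool) (i : List Γ) (o d h : List Bool) :
    (writeOutput Γ).Runs (treeStore i o ((toTree l).word ++ d) h)
      (treeStore i (l.reverse ++ o) (false :: d) h) (7 * l.length + 1) := by
  induction l generalizing o with
  | nil => exact (runs_loop_of_not rfl).mono (by omega)
  | cons b l ih =>
    have h₂ := ih (b :: o)
    simp only [List.reverse_cons, List.append_assoc, List.singleton_append]
    cases b with
    | false =>
      have h₁ := (runs_pop_side (i := i) (o := o) ((toTree l).word ++ d) h false).seq
        (runs_push_out false)
      exact (Runs.loop rfl ((runs_pop_side _ _ true).seq (Runs.case h₁)) h₂).mono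
        (by simp; omega)
    | true =>
      have h₁ := (runs_pop_side (i := i) (o := o) (false :: false :: ((toTree l).word ++ d)) h
        true).seq ((runs_pop_side _ h false).seq ((runs_pop_side _ h false).seq
        (runs_push_out true)))
      exact (Runs.loop rfl ((runs_pop_side _ _ true).seq (Runs.case h₁)) h₂).mono
        (by simp; omega)

/-- The machine that runs `F`, from `inp` to `out`. Before it halts it resets its internal state, as
`haltList` demands. -/
def machine [Fintype Γ] (F : Frag (StkSym Γ)) : FinTM2 where
  K := Stk
  k₀ := .inp
  k₁ := .out
  Γ := StkSym Γ
  Λ := Option F.Lab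
  main := some F.start
  σ := Reg (StkSym Γ)
  initialState := fun _ => none
  m
    | some l => F.code some none l
    | none => .load (fun _ _ => none) .halt

theorem Runs.outputsInTime [Fintype Γ] {F : Frag (StkSym Γ)} {w : List Γ} {o : List Bool} {t : ℕ}
    (hF : F.Runs (treeStore w [] [] []) (treeStore [] o [] []) t) :
    Nonempty (TM2OutputsInTime F.machine w (some o) (t + 1)) := by
  obtain ⟨v, j, hj, h⟩ := hF _ F.machine.m some none (fun _ => rfl) (fun _ => none)
  have hi : initList F.machine w = ⟨some (some F.start), fun _ => none, treeStore w [] [] []⟩ := by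
    refine congrArg (TM2.Cfg.mk _ _) (funext fun k => ?_)
    rcases k with _ | _ | (_ | _) | _ | _ <;> rfl
  have ho : haltList F.machine o = ⟨none, fun _ => none, treeStore [] o [] []⟩ := by
    refine congrArg (TM2.Cfg.mk _ _) (funext fun k => ?_)
    rcases k with _ | _ | (_ | _) | _ | _ <;> rfl
  refine ⟨⟨⟨1 + j, ?_⟩, (Nat.add_comm 1 j).trans_le (Nat.succ_le_succ hj)⟩⟩
  change _ = some (haltList F.machine o)
  rw [hi, ho, Function.iterate_add_apply]
  exact congrArg _ h

end Frag

open Frag in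
/-- Functions in polynomial time on codes are in polynomial time on multi-stack machines. Symbols
of the input are numbered by `sym`; reading and writing a list on stacks reverse it. -/
theorem PolyTime.polyTimeComputable_reverse {α Γ : Type} [Fintype Γ] (sym : Γ → ℕ)
    {ea : α → List Γ} {f : α → List Bool} {F : List ℕ → List Bool} (hF : PolyTime F)
    (h : ∀ a, F ((ea a).map sym).reverse = (f a).reverse) : PolyTimeComputable ea f := by
  obtain ⟨P, p, hP⟩ := hF Γ
  let m := Finset.univ.sup fun s => codeSize (sym s)
  have hm (s : Γ) : codeSize (sym s) ≤ m := Finset.le_sup (f := fun s => codeSize (sym s))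
    (Finset.mem_univ s)
  have hsize (w : List Γ) : codeSize (w.map sym).reverse ≤ w.length * (m + 1) + 1 := by
    rw [codeSize_reverse]
    simpa using codeSize_le_of_forall (l := w.map sym) (m := m) (by simpa using fun s _ => hm s)
  let M : Frag (StkSym Γ) := (push (.side false) false).seq ((readInput sym).seq
    (P.seq ((writeOutput Γ).seq (pop (.side false)))))
  let q : Polynomial ℕ := Polynomial.X * Polynomial.C (m + 1) + 1
  refine ⟨⟨⟨M.machine, Equiv.refl _, Equiv.refl _⟩,
    Polynomial.C (m + 5) * Polynomial.X + 8 * p.comp q + 6, fun a => ?_⟩⟩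
  have hrun := (runs_push_side (i := ea a) (o := []) [] [] false).seq
    ((runs_readInput hm (ea a) [] [] [] []).seq
      (((hP _).2 _ _ _ _).seq ((runs_writeOutput _ _ _ _ _).seq (runs_pop_side _ _ _))))
  simp only [List.append_nil] at hrun
  rw [h, List.reverse_reverse] at hrun
  have hM : M.Runs _ _ _ := hrun.mono (t₂ := (Polynomial.C (m + 5) * Polynomial.X +
      8 * p.comp q + 5).eval (ea a).length) (by
    have h₁ := (hP ((ea a).map sym).reverse).1
    have h₂ := p.eval_mono_nat (hsize (ea a))
    rw [h] at h₁
    have h₃ := length_le_codeSize (f a).reverse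
    rw [List.length_reverse] at *
    simp [q]
    rw [mul_comm (m + 5)]
    omega)
  have hout := hM.outputsInTime
  have hcast {w w' : List Γ} {o o' : List Bool} {t t' : ℕ} (hw : w = w') (ho : o = o')
      (ht : t = t') (h : Nonempty (TM2OutputsInTime M.machine w (some o) t)) :
      Nonempty (TM2OutputsInTime M.machine w' (some o') t') := by
    subst hw ho ht
    exact h
  exact Classical.choice (hcast (List.map_id _).symm (List.map_id _).symm (by simp) hout)

/-! ### Closure properties of polynomial time -/

attribute [fun_prop] PolyTime

theorem codeSize_le_of_mem {α : Type} [TreeCode α] {a : α} {l : List α} (h : a ∈ l) :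
    codeSize a ≤ codeSize l := by
  induction l with
  | nil => simp at h
  | cons b l ih =>
    rcases List.mem_cons.1 h with rfl | h
    · simp; omega
    · have := ih h
      simp; omega

namespace PolyTime

variable {α β γ δ : Type} [TreeCode α] [TreeCode β] [TreeCode γ] [TreeCode δ]

attribute [fun_prop] PolyTime.id PolyTime.comp PolyTime.const PolyTime.pair

@[fun_prop]
theorem fst {f : α → β × γ} (hf : PolyTime f) : PolyTime fun a => (f a).1 := prodFst.comp hf

@[fun_prop]
theorem snd {f : α → β × γ} (hf : PolyTime f) : PolyTime fun a => (f a).2 := prodSnd.comp hf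

@[fun_prop]
theorem cons {f : α → β} {l : α → List β} (hf : PolyTime f) (hl : PolyTime l) :
    PolyTime fun a => f a :: l a :=
  (hf.pair hl).of_code fun a => ⟨a, rfl, rfl⟩

@[fun_prop]
theorem succ {f : α → ℕ} (hf : PolyTime f) : PolyTime fun a => f a + 1 :=
  ((const ()).pair hf).of_code fun a => ⟨a, rfl, rfl⟩

@[fun_prop]
theorem ite {c : α → Bool} {f g : α → β} (hc : PolyTime c) (hf : PolyTime f) (hg : PolyTime g) :
    PolyTime fun a => if c a = true then f a else g a :=
  branch hc hg hf (fun a h => ⟨a, rfl, by cases hca : c a <;> simp_all [toTree]⟩)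
    (fun a h => ⟨a, rfl, by cases hca : c a <;> simp_all [toTree]⟩)

theorem listCases {l : α → List γ} {f : α → β} {g : α → γ → List γ → β} (hl : PolyTime l)
    (hf : PolyTime f) (hg : PolyTime fun p : α × γ × List γ => g p.1 p.2.1 p.2.2) :
    PolyTime fun a => (List.casesOn (l a) (f a) (g a) : β) := by
  have : PolyTime fun p : α × List γ => (List.casesOn p.2 (f p.1) (g p.1) : β) := by
    refine branch prodSnd (hf.comp (prodFst (β := List γ))) hg ?_ ?_
    · rintro ⟨a, _ | ⟨x, t⟩⟩ h
      · exact ⟨_, rfl, rfl⟩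
      · cases h
    · rintro ⟨a, _ | ⟨x, t⟩⟩ h
      · exact absurd rfl h
      · exact ⟨(a, x, t), rfl, rfl⟩
  exact this.comp (id.pair hl)

theorem foldl {l : α → List γ} {i : α → β} {f : α → β → γ → β} (hl : PolyTime l)
    (hi : PolyTime i) (hf : PolyTime fun p : α × β × γ => f p.1 p.2.1 p.2.2)
    (hb : ∃ b : Polynomial ℕ, ∀ a, ∀ j ≤ (l a).length,
      codeSize (((l a).take j).foldl (f a) (i a)) ≤ b.eval (codeSize a)) :
    PolyTime fun a => (l a).foldl (f a) (i a) := by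
  obtain ⟨b, hb⟩ := hb
  obtain ⟨p, hp⟩ := hl.exists_codeSize_le
  let g (s : List γ × α × β) : List γ × α × β :=
    List.casesOn s.1 s fun e t => (t, s.2.1, f s.2.1 s.2.2 e)
  have hg : PolyTime g := by
    refine listCases (by fun_prop) (by fun_prop) ?_
    have := hf.comp (g := fun p : (List γ × α × β) × γ × List γ => (p.1.2.1, p.1.2.2, p.2.1))
      (by fun_prop)
    fun_prop
  have hinit : PolyTime fun a => (l a, a, i a) := by fun_prop
  have hiter (a : α) (j : ℕ) (hj : j ≤ (l a).length) :
      g^[j] (l a, a, i a) = ((l a).drop j, a, ((l a).take j).foldl (f a) (i a)) := by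
    induction j with
    | zero => simp
    | succ j ih =>
      rw [Function.iterate_succ_apply', ih (by omega), List.take_succ_eq_append_getElem hj,
        List.drop_eq_getElem_cons hj]
      simp only [g, List.foldl_append, List.foldl_cons, List.foldl_nil]
  have hsize (a : α) (j : ℕ) : codeSize ((l a).drop j) ≤ p.eval (codeSize a) := by
    refine le_trans ?_ (hp a)
    have := codeSize_append ((l a).take j) ((l a).drop j)
    have := codeSize_pos ((l a).take j)
    rw [List.take_append_drop] at *
    omega
  have := iterate (f := fun a => (a, (l a).foldl (f a) (i a))) hinit hg (fun a => (l a).length)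
    (fun a j hj => by
      rw [hiter a j hj.le, List.drop_eq_getElem_cons hj]
      exact ⟨_, _, _, rfl⟩)
    (fun a => by
      rw [hiter a _ le_rfl, List.drop_length, List.take_length]
      rfl)
    ⟨p + Polynomial.X + b + 2, fun a => ⟨?_, fun j hj => ?_⟩⟩
  · exact this.snd
  · have := length_le_codeSize (l a)
    have := hp a
    simp
    omega
  · rw [hiter a j hj]
    have := hb a j hj
    have := hsize a j
    change codeSize ((l a).drop j) + (codeSize a + codeSize _ + 1) + 1 ≤ _
    simp
    omega

/-- A fold whose steps increase the size of the state by at most a polynomial in the size of the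
initial argument. -/
theorem foldl_of_growth {l : α → List γ} {i : α → β} {f : α → β → γ → β} (hl : PolyTime l)
    (hi : PolyTime i) (hf : PolyTime fun p : α × β × γ => f p.1 p.2.1 p.2.2)
    (hb : ∃ q : Polynomial ℕ, ∀ a s, ∀ e ∈ l a,
      codeSize (f a s e) ≤ codeSize s + q.eval (codeSize a)) :
    PolyTime fun a => (l a).foldl (f a) (i a) := by
  obtain ⟨q, hq⟩ := hb
  obtain ⟨p, hp⟩ := hl.exists_codeSize_le
  obtain ⟨r, hr⟩ := hi.exists_codeSize_le
  refine foldl hl hi hf ⟨r + p * q, fun a j hj => ?_⟩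
  have key : ∀ (t : List γ) (s : β), (∀ e ∈ t, e ∈ l a) →
      codeSize (t.foldl (f a) s) ≤ codeSize s + t.length * q.eval (codeSize a) := by
    intro t
    induction t with
    | nil => simp
    | cons e t ih =>
      intro s ht
      have h₁ := hq a s e (ht e List.mem_cons_self)
      have h₂ := ih (f a s e) fun e he => ht e (List.mem_cons_of_mem _ he)
      rw [List.foldl_cons, List.length_cons, add_mul]
      omega
  have h₁ := key ((l a).take j) (i a) fun e he => List.mem_of_mem_take he
  have h₂ := hr a
  have h₃ : ((l a).take j).length * q.eval (codeSize a) ≤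
      p.eval (codeSize a) * q.eval (codeSize a) := by
    refine Nat.mul_le_mul_right _ ?_
    have := length_le_codeSize (l a)
    have := hp a
    rw [List.length_take]
    omega
  simp
  omega

@[fun_prop]
theorem reverse {l : α → List γ} (hl : PolyTime l) : PolyTime fun a => (l a).reverse := by
  have : PolyTime fun a => (l a).foldl (fun s e => e :: s) [] := by
    refine foldl_of_growth hl (by fun_prop) (by fun_prop) ?_
    obtain ⟨p, hp⟩ := hl.exists_codeSize_le
    refine ⟨p + 1, fun a s e he => ?_⟩
    have := codeSize_le_of_mem he
    have := hp a
    simp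
    omega
  simpa using this

/-- The size of `f a e` for `e ∈ l a` is polynomial in the size of `a`. -/
theorem exists_codeSize_le_of_mem {l : α → List γ} {f : α → γ → δ} (hl : PolyTime l)
    (hf : PolyTime fun p : α × γ => f p.1 p.2) :
    ∃ q : Polynomial ℕ, ∀ a, ∀ e ∈ l a, codeSize (f a e) ≤ q.eval (codeSize a) := by
  obtain ⟨p, hp⟩ := hl.exists_codeSize_le
  obtain ⟨r, hr⟩ := hf.exists_codeSize_le
  refine ⟨r.comp (Polynomial.X + p + 1), fun a e he => (hr (a, e)).trans ?_⟩
  rw [Polynomial.eval_comp]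
  refine r.eval_mono_nat ?_
  have h₁ := codeSize_le_of_mem he
  have h₂ := hp a
  change codeSize a + codeSize e + 1 ≤ _
  simp
  omega

@[fun_prop]
theorem map {l : α → List γ} {f : α → γ → δ} (hl : PolyTime l)
    (hf : PolyTime fun p : α × γ => f p.1 p.2) : PolyTime fun a => (l a).map (f a) := by
  have : PolyTime fun a => ((l a).foldl (fun s e => f a e :: s) []).reverse := by
    refine reverse (foldl_of_growth (f := fun a s e => f a e :: s) hl (by fun_prop) ?_ ?_)
    · have := hf.comp (g := fun p : α × List δ × γ => (p.1, p.2.2)) (by fun_prop)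
      fun_prop
    · obtain ⟨q, hq⟩ := exists_codeSize_le_of_mem hl hf
      refine ⟨q + 1, fun a s e he => ?_⟩
      have := hq a e he
      simp
      omega
  have key (a : α) : ∀ (t : List γ) (s : List δ),
      t.foldl (fun s e => f a e :: s) s = (t.map (f a)).reverse ++ s := by
    intro t
    induction t with
    | nil => simp
    | cons e t ih => simp [ih]
  simpa [key] using this

@[fun_prop]
theorem filter {l : α → List γ} {f : α → γ → Bool} (hl : PolyTime l)
    (hf : PolyTime fun p : α × γ => f p.1 p.2) : PolyTime fun a => (l a).filter (f a) := by
  have : PolyTime fun a =>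
      ((l a).foldl (fun s e => if f a e = true then e :: s else s) []).reverse := by
    refine reverse (foldl_of_growth (f := fun a s e => if f a e = true then e :: s else s) hl
      (by fun_prop) ?_ ?_)
    · have := hf.comp (g := fun p : α × List γ × γ => (p.1, p.2.2)) (by fun_prop)
      fun_prop
    · obtain ⟨q, hq⟩ := hl.exists_codeSize_le
      refine ⟨q + 1, fun a s e he => ?_⟩
      have := hq a
      have := codeSize_le_of_mem he
      split <;> simp
      omega
  have key (a : α) : ∀ (t s : List γ),
      t.foldl (fun s e => if f a e = true then e :: s else s) s =
        (t.filter (f a)).reverse ++ s := by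
    intro t
    induction t with
    | nil => simp
    | cons e t ih =>
      intro s
      cases h : f a e <;> simp [ih, h]
  simpa [key] using this

@[fun_prop]
theorem append {l l' : α → List γ} (hl : PolyTime l) (hl' : PolyTime l') :
    PolyTime fun a => l a ++ l' a := by
  have : PolyTime fun a => (l a).reverse.foldl (fun s e => e :: s) (l' a) := by
    refine foldl_of_growth (by fun_prop) hl' (by fun_prop) ?_
    obtain ⟨p, hp⟩ := hl.exists_codeSize_le
    refine ⟨p + 1, fun a s e he => ?_⟩
    have := codeSize_le_of_mem (List.mem_reverse.1 he)
    have := hp a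
    simp
    omega
  simpa using this

@[fun_prop]
theorem flatMap {l : α → List γ} {f : α → γ → List δ} (hl : PolyTime l)
    (hf : PolyTime fun p : α × γ => f p.1 p.2) : PolyTime fun a => (l a).flatMap (f a) := by
  have : PolyTime fun a => (l a).foldl (fun s e => s ++ f a e) [] := by
    refine foldl_of_growth (f := fun a s e => s ++ f a e) hl (by fun_prop) ?_ ?_
    · have := hf.comp (g := fun p : α × List δ × γ => (p.1, p.2.2)) (by fun_prop)
      fun_prop
    · obtain ⟨q, hq⟩ := exists_codeSize_le_of_mem hl hf
      refine ⟨q + 1, fun a s e he => ?_⟩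
      have := hq a e he
      have := codeSize_append s (f a e)
      simp
      omega
  simpa [List.flatMap_eq_foldl] using this

@[fun_prop]
theorem and {f g : α → Bool} (hf : PolyTime f) (hg : PolyTime g) :
    PolyTime fun a => f a && g a := by
  have : PolyTime fun a => if f a = true then g a else false := by fun_prop
  convert this using 2 with a
  cases f a <;> rfl

@[fun_prop]
theorem or {f g : α → Bool} (hf : PolyTime f) (hg : PolyTime g) :
    PolyTime fun a => f a || g a := by
  have : PolyTime fun a => if f a = true then true else g a := by fun_prop
  convert this using 2 with a
  cases f a <;> rfl

@[fun_prop]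
theorem not {f : α → Bool} (hf : PolyTime f) : PolyTime fun a => !(f a) := by
  have : PolyTime fun a => if f a = true then false else true := by fun_prop
  convert this using 2 with a
  cases f a <;> rfl

theorem codeSize_bool_le (b : Bool) : codeSize b ≤ 3 := by cases b <;> decide

@[fun_prop]
theorem all {l : α → List γ} {f : α → γ → Bool} (hl : PolyTime l)
    (hf : PolyTime fun p : α × γ => f p.1 p.2) : PolyTime fun a => (l a).all (f a) := by
  have : PolyTime fun a =>
      (List.casesOn ((l a).filter fun e => !(f a e)) true fun _ _ => false : Bool) :=
    listCases (by fun_prop) (by fun_prop) (by fun_prop)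
  convert this using 2 with a
  induction l a with
  | nil => rfl
  | cons e t ih => cases h : f a e <;> simp [h, ih]

@[fun_prop]
theorem any {l : α → List γ} {f : α → γ → Bool} (hl : PolyTime l)
    (hf : PolyTime fun p : α × γ => f p.1 p.2) : PolyTime fun a => (l a).any (f a) := by
  have : PolyTime fun a => !((l a).all fun e => !(f a e)) := by fun_prop
  simpa [List.all_eq_not_any_not] using this

@[fun_prop]
theorem headD {l : α → List γ} {f : α → γ} (hl : PolyTime l) (hf : PolyTime f) :
    PolyTime fun a => (l a).headD (f a) := by
  have : PolyTime fun a => (List.casesOn (l a) (f a) fun x _ => x : γ) :=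
    listCases (by fun_prop) (by fun_prop) (by fun_prop)
  convert this using 2 with a
  cases l a <;> rfl

@[fun_prop]
theorem tail {l : α → List γ} (hl : PolyTime l) : PolyTime fun a => (l a).tail := by
  have : PolyTime fun a => (List.casesOn (l a) [] fun _ t => t : List γ) :=
    listCases (by fun_prop) (by fun_prop) (by fun_prop)
  convert this using 2 with a
  cases l a <;> rfl

theorem toTree_replicate_unit (n : ℕ) : toTree (List.replicate n ()) = toTree n := by
  induction n with
  | zero => rfl
  | succ n ih => exact congrArg (BTree.node .leaf) ih

@[fun_prop]
theorem replicate {n : α → ℕ} (hn : PolyTime n) : PolyTime fun a => List.replicate (n a) () :=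
  hn.of_code fun a => ⟨a, rfl, (toTree_replicate_unit _).symm⟩

@[fun_prop]
theorem length {l : α → List γ} (hl : PolyTime l) : PolyTime fun a => (l a).length := by
  have : PolyTime fun a => (l a).map fun _ => () := by fun_prop
  refine this.of_code fun a => ⟨a, rfl, ?_⟩
  rw [List.map_const', toTree_replicate_unit]

theorem codeSize_nat (n : ℕ) : codeSize n = 2 * n + 1 := by
  induction n with
  | zero => rfl
  | succ n ih =>
    change 1 + codeSize n + 1 = _
    omega

theorem natIterate {n : α → ℕ} {i : α → β} {f : α → β → β} (hn : PolyTime n)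
    (hi : PolyTime i) (hf : PolyTime fun p : α × β => f p.1 p.2)
    (hb : ∃ b : Polynomial ℕ, ∀ a, ∀ j ≤ n a, codeSize ((f a)^[j] (i a)) ≤ b.eval (codeSize a)) :
    PolyTime fun a => (f a)^[n a] (i a) := by
  have key (a : α) (j : ℕ) (s : β) :
      (List.replicate j ()).foldl (fun s _ => f a s) s = (f a)^[j] s := by
    induction j generalizing s with
    | zero => rfl
    | succ j ih => simp [List.replicate_succ, ih]
  have : PolyTime fun a => (List.replicate (n a) ()).foldl (fun s _ => f a s) (i a) := by
    refine foldl (f := fun a s _ => f a s) (by fun_prop) hi ?_ ?_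
    · have := hf.comp (g := fun p : α × β × Unit => (p.1, p.2.1)) (by fun_prop)
      fun_prop
    · obtain ⟨b, hb⟩ := hb
      refine ⟨b, fun a j hj => ?_⟩
      rw [List.length_replicate] at hj
      rw [List.take_replicate, key, min_eq_left hj]
      exact hb a j hj
  simpa [key] using this

@[fun_prop]
theorem natMul {f g : α → ℕ} (hf : PolyTime f) (hg : PolyTime g) :
    PolyTime fun a => f a * g a := by
  have : PolyTime fun a =>
      ((List.replicate (f a) ()).flatMap fun _ => List.replicate (g a) ()).length := by
    fun_prop
  simpa using this

@[fun_prop]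
theorem drop {n : α → ℕ} {l : α → List γ} (hn : PolyTime n) (hl : PolyTime l) :
    PolyTime fun a => (l a).drop (n a) := by
  have key (j : ℕ) (l : List γ) : List.tail^[j] l = l.drop j := by
    induction j generalizing l with
    | zero => rfl
    | succ j ih => cases l <;> simp [ih]
  have : PolyTime fun a => List.tail^[n a] (l a) := by
    refine natIterate (f := fun _ => List.tail) hn hl (by fun_prop) ?_
    obtain ⟨p, hp⟩ := hl.exists_codeSize_le
    refine ⟨p, fun a j _ => le_trans ?_ (hp a)⟩
    rw [key]
    have := codeSize_append ((l a).take j) ((l a).drop j)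
    have := codeSize_pos ((l a).take j)
    rw [List.take_append_drop] at *
    omega
  simpa [key] using this

@[fun_prop]
theorem getD {n : α → ℕ} {l : α → List γ} {f : α → γ} (hl : PolyTime l) (hn : PolyTime n)
    (hf : PolyTime f) : PolyTime fun a => (l a).getD (n a) (f a) := by
  have : PolyTime fun a => ((l a).drop (n a)).headD (f a) := by fun_prop
  simpa [List.headD_eq_head?_getD, List.head?_drop, List.getD_eq_getElem?_getD] using this

@[fun_prop]
theorem natSub {f g : α → ℕ} (hf : PolyTime f) (hg : PolyTime g) :
    PolyTime fun a => f a - g a := by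
  have : PolyTime fun a => ((List.replicate (f a) ()).drop (g a)).length := by fun_prop
  simpa using this

@[fun_prop]
theorem natLe {f g : α → ℕ} (hf : PolyTime f) (hg : PolyTime g) :
    PolyTime fun a => decide (f a ≤ g a) := by
  have : PolyTime fun a => ((List.replicate (f a) ()).drop (g a)).all fun _ => false := by fun_prop
  convert this using 2 with a
  rw [List.drop_replicate]
  rcases Nat.lt_or_ge (g a) (f a) with h | h
  · obtain ⟨k, hk⟩ := Nat.exists_eq_add_of_lt h
    rw [show f a - g a = k + 1 by omega]
    simpa [List.replicate_succ] using h
  · simpa [Nat.sub_eq_zero_of_le h] using h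

@[fun_prop]
theorem natLt {f g : α → ℕ} (hf : PolyTime f) (hg : PolyTime g) :
    PolyTime fun a => decide (f a < g a) := by
  have : PolyTime fun a => decide (f a + 1 ≤ g a) := by fun_prop
  exact this

@[fun_prop]
theorem natEq {f g : α → ℕ} (hf : PolyTime f) (hg : PolyTime g) :
    PolyTime fun a => decide (f a = g a) := by
  have : PolyTime fun a => decide (f a ≤ g a) && decide (g a ≤ f a) := by fun_prop
  convert this using 2 with a
  rw [← Bool.decide_and, decide_eq_decide]
  omega

@[fun_prop]
theorem range {n : α → ℕ} (hn : PolyTime n) : PolyTime fun a => List.range (n a) := by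
  have key (j : ℕ) : (fun l : List ℕ => l.length :: l)^[j] [] = (List.range j).reverse := by
    induction j with
    | zero => rfl
    | succ j ih => rw [Function.iterate_succ_apply', ih, List.range_succ]; simp
  have : PolyTime fun a => ((fun l : List ℕ => l.length :: l)^[n a] []).reverse := by
    refine reverse (natIterate (f := fun _ (l : List ℕ) => l.length :: l) hn (by fun_prop)
      (by fun_prop) ?_)
    obtain ⟨p, hp⟩ := hn.exists_codeSize_le
    refine ⟨p * (p + 1) + 1, fun a j hj => ?_⟩
    have hpa := hp a
    rw [codeSize_nat] at hpa
    rw [key]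
    refine (codeSize_le_of_forall (m := p.eval (codeSize a)) fun e he => ?_).trans ?_
    · rw [List.mem_reverse, List.mem_range] at he
      rw [codeSize_nat]
      omega
    · simp only [List.length_reverse, List.length_range, Polynomial.eval_add,
        Polynomial.eval_mul, Polynomial.eval_one]
      exact Nat.succ_le_succ (Nat.mul_le_mul_right _ (by omega))
  simpa [key] using this

@[fun_prop]
theorem listNatEq {f g : α → List ℕ} (hf : PolyTime f) (hg : PolyTime g) :
    PolyTime fun a => decide (f a = g a) := by
  have : PolyTime fun a => decide ((f a).length = (g a).length) &&
      (List.range (f a).length).all fun j => decide ((f a).getD j 0 = (g a).getD j 0) := by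
    fun_prop
  convert this using 2 with a
  rw [Bool.eq_iff_iff]
  simp only [decide_eq_true_eq, Bool.and_eq_true, List.all_eq_true, List.mem_range]
  constructor
  · intro h
    simp [h]
  · rintro ⟨h₁, h₂⟩
    refine List.ext_getElem h₁ fun j hj hj' => ?_
    simpa [hj, hj'] using h₂ j hj

end PolyTime

/-! ### Minimum vertex covers of bipartite graphs by an auction -/

namespace Auction

/-- Adjacency in the bipartite graph with the list of edges `E`. -/
def adj (E : List (ℕ × ℕ)) (u v : ℕ) : Bool := E.any fun e => decide (e.1 = u) && decide (e.2 = v)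

theorem adj_iff {E : List (ℕ × ℕ)} {u v : ℕ} : adj E u v = true ↔ (u, v) ∈ E := by
  simp only [adj, List.any_eq_true, Bool.and_eq_true, decide_eq_true_eq]
  exact ⟨fun ⟨e, he, h₁, h₂⟩ => by subst h₁ h₂; exact he, fun h => ⟨_, h, rfl, rfl⟩⟩

/-- The bidders without an item. In a state of the auction the entry `(v, p, o)` says that the item
`v` has price `p` and belongs to the bidder `o - 1` if `o ≠ 0`, and to nobody if `o = 0`. -/
def free (L : List ℕ) (S : List (ℕ × ℕ × ℕ)) : List ℕ :=
  L.filter fun u => S.all fun t => !decide (t.2.2 = u + 1)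

/-- The admissible bids: a bidder `u` without an item bids for an item that is cheapest among its
neighbours, provided that the price of this item is less than `lim`. -/
def bids (E : List (ℕ × ℕ)) (L : List ℕ) (lim : ℕ) (S : List (ℕ × ℕ × ℕ)) : List (ℕ × ℕ) :=
  (free L S).flatMap fun u => (S.filter fun t => adj E u t.1 && (decide (t.2.1 < lim) &&
    S.all fun t' => !adj E u t'.1 || decide (t.2.1 ≤ t'.2.1))).map fun t => (u, t.1)

/-- The bidder `u` gets the item `v`, whose price rises by one. -/
def sell (u v : ℕ) (S : List (ℕ × ℕ × ℕ)) : List (ℕ × ℕ × ℕ) :=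
  S.map fun t => if decide (t.1 = v) = true then (t.1, t.2.1 + 1, u + 1) else t

/-- One round of the auction accepts one bid. -/
def bidRound (E : List (ℕ × ℕ)) (L : List ℕ) (lim : ℕ) (S : List (ℕ × ℕ × ℕ)) : List (ℕ × ℕ × ℕ) :=
  List.casesOn (bids E L lim S) S fun b _ => sell b.1 b.2 S

/-- The state at the end of the auction, with bidders `L`, items `R` and price limit `|R| + 1`. Each
accepted bid raises the sum of the prices, which is at most `(|R| + 1) |R|`. -/
def final (E : List (ℕ × ℕ)) (L R : List ℕ) : List (ℕ × ℕ × ℕ) :=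
  (bidRound E L (R.length + 1))^[(R.length + 1) * R.length + 1] (R.map fun v => (v, 0, 0))

/-- A positive number that is not a price. There is one among `1, …, |R| + 1`, since there are only
`|R|` prices. -/
def gap (S : List (ℕ × ℕ × ℕ)) : ℕ :=
  ((List.range (S.length + 1)).filter fun g => S.all fun t => !decide (t.2.1 = g + 1)).headD 0 + 1

/-- The bidders with a neighbour whose price is less than `g`. -/
def leftCover (E : List (ℕ × ℕ)) (L : List ℕ) (S : List (ℕ × ℕ × ℕ)) (g : ℕ) : List ℕ :=
  L.filter fun u => S.any fun t => adj E u t.1 && decide (t.2.1 < g)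

/-- The items whose price is more than `g`. -/
def rightCover (S : List (ℕ × ℕ × ℕ)) (g : ℕ) : List ℕ :=
  (S.filter fun t => decide (g < t.2.1)).map fun t => t.1

/-- The invariant of the auction, besides the price limit `le`: nobody owns two items (`inj`), an
item with a positive price has an owner (`pos`), and an owned item is a neighbour of its owner with
a price that exceeds the prices of the other neighbours by at most one (`owner`). -/
structure Inv (E : List (ℕ × ℕ)) (L R : List ℕ) (lim : ℕ) (S : List (ℕ × ℕ × ℕ)) : Prop where
  map_fst : S.map (fun t => t.1) = R
  le : ∀ t ∈ S, t.2.1 ≤ lim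
  owner : ∀ t ∈ S, t.2.2 ≠ 0 → ∃ u ∈ L, t.2.2 = u + 1 ∧ (u, t.1) ∈ E ∧
    ∀ t' ∈ S, (u, t'.1) ∈ E → t.2.1 ≤ t'.2.1 + 1
  inj : ∀ t ∈ S, ∀ t' ∈ S, t.2.2 ≠ 0 → t.2.2 = t'.2.2 → t = t'
  pos : ∀ t ∈ S, t.2.1 ≠ 0 → t.2.2 ≠ 0

variable {E : List (ℕ × ℕ)} {L R : List ℕ} {lim : ℕ} {S : List (ℕ × ℕ × ℕ)}

theorem mem_bids {u v : ℕ} : (u, v) ∈ bids E L lim S ↔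
    u ∈ L ∧ (∀ t ∈ S, t.2.2 ≠ u + 1) ∧ ∃ t ∈ S, t.1 = v ∧ (u, t.1) ∈ E ∧ t.2.1 < lim ∧
      ∀ t' ∈ S, (u, t'.1) ∈ E → t.2.1 ≤ t'.2.1 := by
  simp only [bids, free, List.mem_flatMap, List.mem_filter, List.all_eq_true, Bool.not_eq_true',
    List.mem_map, Bool.and_eq_true, adj_iff, decide_eq_true_eq,
    Bool.or_eq_true, Prod.mk.injEq, ← Bool.not_eq_true]
  constructor
  · rintro ⟨_, ⟨h₁, h₂⟩, t, ⟨h₃, h₄, h₅, h₆⟩, rfl, h₇⟩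
    exact ⟨h₁, h₂, t, h₃, h₇, h₄, h₅, fun t' h h' => (h₆ t' h).resolve_left (not_not_intro h')⟩
  · rintro ⟨h₁, h₂, t, h₃, h₇, h₄, h₅, h₆⟩
    exact ⟨u, ⟨h₁, h₂⟩, t, ⟨h₃, h₄, h₅, fun t' h => or_iff_not_imp_left.2
      fun h' => h₆ t' h (not_not.1 h')⟩, rfl, h₇⟩

theorem Inv.eq_of_fst (h : Inv E L R lim S) (hR : R.Nodup) {t t' : ℕ × ℕ × ℕ} (ht : t ∈ S)
    (ht' : t' ∈ S) (e : t.1 = t'.1) : t = t' :=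
  List.inj_on_of_nodup_map (h.map_fst ▸ hR) ht ht' e

theorem Inv.init : Inv E L R lim (R.map fun v => (v, 0, 0)) where
  map_fst := by simp [Function.comp_def]
  le := by simp
  owner := by simp
  inj := by simp
  pos := by simp

theorem Inv.sell (h : Inv E L R lim S) (hR : R.Nodup) {u v : ℕ} (hb : (u, v) ∈ bids E L lim S) :
    Inv E L R lim (sell u v S) := by
  obtain ⟨hu, hfree, s, hs, rfl, hE, hlt, hmin⟩ := mem_bids.1 hb
  -- An entry after the sale is the entry of `s` with the new price and owner, or an old entry.
  have hmem {t : ℕ × ℕ × ℕ} (ht : t ∈ Auction.sell u s.1 S) :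
      t = (s.1, s.2.1 + 1, u + 1) ∨ (t ∈ S ∧ t.1 ≠ s.1) := by
    obtain ⟨r, hr, rfl⟩ := List.mem_map.1 ht
    by_cases e : r.1 = s.1
    · obtain rfl := h.eq_of_fst hR hr hs e
      simp
    · simp [e, hr]
  -- Prices do not fall.
  have hle {t : ℕ × ℕ × ℕ} (ht : t ∈ Auction.sell u s.1 S) :
      ∃ r ∈ S, r.1 = t.1 ∧ r.2.1 ≤ t.2.1 := by
    rcases hmem ht with rfl | ⟨h', -⟩
    · exact ⟨s, hs, rfl, Nat.le_succ _⟩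
    · exact ⟨t, h', rfl, le_rfl⟩
  refine ⟨?_, fun t ht => ?_, fun t ht h0 => ?_, fun t ht t' ht' h0 e => ?_, fun t ht h0 => ?_⟩
  · rw [← h.map_fst, Auction.sell, List.map_map]
    refine List.map_congr_left fun t _ => ?_
    by_cases e : t.1 = s.1 <;> simp [e]
  · rcases hmem ht with rfl | ⟨h', -⟩
    · exact hlt
    · exact h.le t h'
  · rcases hmem ht with rfl | ⟨h', -⟩
    · refine ⟨u, hu, rfl, hE, fun t' ht' he => ?_⟩
      obtain ⟨r, hr, e, hrt⟩ := hle ht'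
      have := hmin r hr (e ▸ he)
      dsimp only
      omega
    · obtain ⟨w, hw, e, he, hm⟩ := h.owner t h' h0
      refine ⟨w, hw, e, he, fun t' ht' he' => ?_⟩
      obtain ⟨r, hr, e, hrt⟩ := hle ht'
      have := hm r hr (e ▸ he')
      omega
  · rcases hmem ht with rfl | ⟨h₁, -⟩ <;> rcases hmem ht' with rfl | ⟨h₂, -⟩
    · rfl
    · exact absurd e.symm (hfree t' h₂)
    · exact absurd e (hfree t h₁)
    · exact h.inj t h₁ t' h₂ h0 e
  · rcases hmem ht with rfl | ⟨h', -⟩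
    · simp
    · exact h.pos t h' h0

theorem Inv.bidRound (h : Inv E L R lim S) (hR : R.Nodup) : Inv E L R lim (bidRound E L lim S) := by
  unfold Auction.bidRound
  rcases hb : bids E L lim S with _ | ⟨⟨u, v⟩, l⟩
  · exact h
  · exact h.sell hR (hb ▸ List.mem_cons_self)

theorem Inv.iterate (hR : R.Nodup) (j : ℕ) :
    Inv E L R lim ((Auction.bidRound E L lim)^[j] (R.map fun v => (v, 0, 0))) := by
  induction j with
  | zero => exact .init
  | succ j ih =>
    rw [Function.iterate_succ_apply']
    exact ih.bidRound hR

/-- The sum of the prices. -/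
def total (S : List (ℕ × ℕ × ℕ)) : ℕ := (S.map fun t => t.2.1).sum

theorem total_bidRound (h : bids E L lim S ≠ []) : total S < total (bidRound E L lim S) := by
  unfold bidRound
  rcases hb : bids E L lim S with _ | ⟨⟨u, v⟩, l⟩
  · exact absurd hb h
  · change total S < total (sell u v S)
    obtain ⟨-, -, s, hs, rfl, -⟩ := mem_bids.1 (hb ▸ List.mem_cons_self : (u, v) ∈ bids E L lim S)
    rw [total, total, Auction.sell, List.map_map]
    refine List.sum_lt_sum _ _ (fun t _ => ?_) ⟨s, hs, ?_⟩
    · by_cases e : t.1 = s.1 <;> simp [e]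
    · simp

theorem Inv.total_le (h : Inv E L R lim S) : total S ≤ lim * R.length := by
  have := List.sum_le_card_nsmul (S.map fun t => t.2.1) lim (by
    intro p hp
    obtain ⟨t, ht, rfl⟩ := List.mem_map.1 hp
    exact h.le t ht)
  rw [← h.map_fst, total]
  simpa [mul_comm] using this

/-- The price limit bounds the number of rounds, so at the end no bid is possible. -/
theorem bids_final (hR : R.Nodup) : bids E L (R.length + 1) (final E L R) = [] := by
  have key (lim j : ℕ) : bids E L lim ((bidRound E L lim)^[j] (R.map fun v => (v, 0, 0))) = [] ∨
      j ≤ total ((bidRound E L lim)^[j] (R.map fun v => (v, 0, 0))) := by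
    induction j with
    | zero => exact .inr (Nat.zero_le _)
    | succ j ih =>
      rw [Function.iterate_succ_apply']
      rcases ih with h | h
      · left
        rw [bidRound, h]
        exact h
      · by_cases hb : bids E L lim ((bidRound E L lim)^[j] (R.map fun v => (v, 0, 0))) = []
        · left
          rw [bidRound, hb]
          exact hb
        · exact .inr (h.trans_lt (total_bidRound hb))
  refine (key _ _).resolve_right fun h => ?_
  have := (Inv.iterate (E := E) (L := L) (lim := R.length + 1) hR
    ((R.length + 1) * R.length + 1)).total_le
  omega

theorem gap_spec (S : List (ℕ × ℕ × ℕ)) :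
    0 < gap S ∧ gap S ≤ S.length + 1 ∧ ∀ t ∈ S, t.2.1 ≠ gap S := by
  unfold gap
  rcases h : (List.range (S.length + 1)).filter fun g => S.all fun t => !decide (t.2.1 = g + 1)
    with _ | ⟨g, l⟩
  · exfalso
    have hsub : (List.range (S.length + 1)).map (· + 1) ⊆ S.map fun t => t.2.1 := by
      intro g hg
      obtain ⟨g, hg', rfl⟩ := List.mem_map.1 hg
      have := List.filter_eq_nil_iff.1 h g hg'
      simp only [List.all_eq_true, not_forall] at this
      obtain ⟨t, ht, he⟩ := this
      exact List.mem_map.2 ⟨t, ht, by simpa using he⟩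
    have := (((List.nodup_range (n := S.length + 1)).map
      (add_left_injective 1)).subperm hsub).length_le
    simp at this
  · have hg := List.mem_filter.1 (h ▸ List.mem_cons_self : g ∈ _)
    simp only [List.mem_range, List.all_eq_true, Bool.not_eq_true', decide_eq_false_iff_not] at hg
    exact ⟨Nat.succ_pos _, by simp; omega, hg.2⟩

/-- No price is equal to the gap, so every edge has its bidder or its item in the cover. -/
theorem cover (h : Inv E L R lim S) {g : ℕ} (hg : ∀ t ∈ S, t.2.1 ≠ g) {u v : ℕ} (hu : u ∈ L)
    (hv : v ∈ R) (he : (u, v) ∈ E) : u ∈ leftCover E L S g ∨ v ∈ rightCover S g := by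
  rw [← h.map_fst] at hv
  obtain ⟨t, ht, rfl⟩ := List.mem_map.1 hv
  rcases Nat.lt_or_gt_of_ne (hg t ht) with h' | h'
  · exact .inl (List.mem_filter.2 ⟨hu, List.any_eq_true.2 ⟨t, ht, by simp [adj_iff, he, h']⟩⟩)
  · exact .inr (List.mem_map.2 ⟨t, List.mem_filter.2 ⟨ht, by simpa using h'⟩, rfl⟩)

/-- The cover is not larger than the matching: a bidder in it has an item, cheaper than the gap,
and an item in it has an owner. -/
theorem cover_le (h : Inv E L R lim S) (hL : L.Nodup) (hb : bids E L lim S = []) {g : ℕ}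
    (hg : ∀ t ∈ S, t.2.1 ≠ g) (hlim : g ≤ lim) :
    (leftCover E L S g).length + (rightCover S g).length ≤
      (S.filter fun t => !decide (t.2.2 = 0)).length := by
  have hleft : leftCover E L S g ⊆
      (S.filter fun t => decide (t.2.1 < g) && !decide (t.2.2 = 0)).map fun t => t.2.2 - 1 := by
    intro u hu
    obtain ⟨hu, s, hs, hsE, hsg⟩ : u ∈ L ∧ ∃ s ∈ S, (u, s.1) ∈ E ∧ s.2.1 < g := by
      simpa [leftCover, adj_iff] using hu
    -- A cheapest neighbour of `u`; without an item `u` could bid for it.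
    obtain ⟨r, hr, hmin⟩ := ((S.filter fun t => adj E u t.1).toFinset).exists_min_image
      (fun t => t.2.1) ⟨s, by simp [hs, adj_iff, hsE]⟩
    simp only [List.mem_toFinset, List.mem_filter, adj_iff, and_imp] at hr hmin
    have hrs := hmin s hs hsE
    have hnb : (u, r.1) ∉ bids E L lim S := by simp [hb]
    rw [mem_bids] at hnb
    obtain ⟨t, ht, htu⟩ : ∃ t ∈ S, t.2.2 = u + 1 := by
      by_contra hcon
      push Not at hcon
      exact hnb ⟨hu, hcon, r, hr.1, rfl, hr.2, by omega, hmin⟩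
    obtain ⟨w, -, hw, -, hle⟩ := h.owner t ht (by omega)
    obtain rfl : w = u := by omega
    have := hle s hs hsE
    have := hg t ht
    refine List.mem_map.2 ⟨t, List.mem_filter.2 ⟨ht, ?_⟩, by omega⟩
    simp
    omega
  have h₁ : (leftCover E L S g).length ≤ _ := ((hL.filter _).subperm hleft).length_le
  rw [List.length_map] at h₁
  have h₂ : (rightCover S g).length ≤
      (S.filter fun t => !decide (t.2.1 < g) && !decide (t.2.2 = 0)).length := by
    rw [rightCover, List.length_map, ← List.countP_eq_length_filter, ← List.countP_eq_length_filter]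
    refine List.countP_mono_left fun t ht hlt => ?_
    have := h.pos t ht
    simp at hlt ⊢
    omega
  have h₃ := List.length_eq_length_filter_add (l := S.filter fun t => !decide (t.2.2 = 0))
    fun t => decide (t.2.1 < g)
  simp only [List.filter_filter] at h₃
  omega

/-- The matching is not larger than any vertex cover. -/
theorem matching_le (h : Inv E L R lim S) (hR : R.Nodup) (cl cr : ℕ → Bool)
    (hc : ∀ u ∈ L, ∀ v ∈ R, (u, v) ∈ E → cl u = true ∨ cr v = true) :
    (S.filter fun t => !decide (t.2.2 = 0)).length ≤
      (L.filter cl).length + (R.filter cr).length := by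
  have hS : S.Nodup := List.Nodup.of_map _ (h.map_fst ▸ hR)
  rw [List.length_eq_length_filter_add (fun t => cl (t.2.2 - 1))]
  simp only [List.filter_filter]
  refine add_le_add ?_ ?_
  · rw [← List.length_map (f := fun t : ℕ × ℕ × ℕ => t.2.2 - 1)]
    refine (List.Nodup.subperm ?_ ?_).length_le
    · refine List.Nodup.map_on (fun t ht t' ht' e => ?_) (hS.filter _)
      simp only [List.mem_filter, Bool.and_eq_true, Bool.not_eq_true', decide_eq_false_iff_not]
        at ht ht'
      exact h.inj t ht.1 t' ht'.1 ht.2.2 (by omega)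
    · intro u hu
      obtain ⟨t, ht, rfl⟩ := List.mem_map.1 hu
      simp only [List.mem_filter, Bool.and_eq_true, Bool.not_eq_true', decide_eq_false_iff_not]
        at ht ⊢
      obtain ⟨w, hw, e, -⟩ := h.owner t ht.1 ht.2.2
      rw [show t.2.2 - 1 = w by omega] at *
      exact ⟨hw, ht.2.1⟩
  · rw [← List.length_map (f := fun t : ℕ × ℕ × ℕ => t.1)]
    refine (List.Nodup.subperm ?_ ?_).length_le
    · refine List.Nodup.map_on (fun t ht t' ht' e => ?_) (hS.filter _)
      exact h.eq_of_fst hR (List.mem_of_mem_filter ht) (List.mem_of_mem_filter ht') e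
    · intro v hv
      obtain ⟨t, ht, rfl⟩ := List.mem_map.1 hv
      simp only [List.mem_filter, Bool.and_eq_true, Bool.not_eq_true', decide_eq_false_iff_not]
        at ht ⊢
      obtain ⟨w, hw, e, hE, -⟩ := h.owner t ht.1 ht.2.2
      have hv : t.1 ∈ R := h.map_fst ▸ List.mem_map_of_mem ht.1
      refine ⟨hv, (hc w hw _ hv hE).resolve_left ?_⟩
      rw [show w = t.2.2 - 1 by omega]
      simp [ht.2.1]

/-- The auction ends with a vertex cover, of minimum size. -/
theorem exists_rightCover (hL : L.Nodup) (hR : R.Nodup) :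
    ∃ C : List ℕ, C.Nodup ∧ C ⊆ R ∧
      (∀ u ∈ L, ∀ v ∈ R, (u, v) ∈ E →
        u ∈ leftCover E L (final E L R) (gap (final E L R)) ∨ v ∈ C) ∧
      ∀ cl cr : ℕ → Bool, (∀ u ∈ L, ∀ v ∈ R, (u, v) ∈ E → cl u = true ∨ cr v = true) →
        (leftCover E L (final E L R) (gap (final E L R))).length + C.length ≤
          (L.filter cl).length + (R.filter cr).length := by
  have h : Inv E L R (R.length + 1) (final E L R) := .iterate hR _
  obtain ⟨-, hle, hg⟩ := gap_spec (final E L R)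
  have hlen : (final E L R).length = R.length := by
    rw [← List.length_map (f := fun t => t.1), h.map_fst]
  have hsub : (rightCover (final E L R) (gap (final E L R))).Sublist R := by
    conv_rhs => rw [← h.map_fst]
    exact List.filter_sublist.map _
  exact ⟨_, hR.sublist hsub, hsub.subset, fun u hu v hv he => cover h hg hu hv he,
    fun cl cr hc => (cover_le h hL (bids_final hR) hg (by omega)).trans (matching_le h hR cl cr hc)⟩

end Auction

/-! ### The auction in polynomial time -/

namespace PolyTime

open Auction

variable {α : Type} [TreeCode α]

@[fun_prop]
theorem auctionAdj {E : α → List (ℕ × ℕ)} {u v : α → ℕ} (hE : PolyTime E) (hu : PolyTime u)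
    (hv : PolyTime v) : PolyTime fun a => adj (E a) (u a) (v a) := by
  unfold adj
  fun_prop

@[fun_prop]
theorem auctionFree {L : α → List ℕ} {S : α → List (ℕ × ℕ × ℕ)} (hL : PolyTime L)
    (hS : PolyTime S) : PolyTime fun a => free (L a) (S a) := by
  unfold free
  fun_prop

@[fun_prop]
theorem auctionBids {E : α → List (ℕ × ℕ)} {L : α → List ℕ} {lim : α → ℕ}
    {S : α → List (ℕ × ℕ × ℕ)} (hE : PolyTime E) (hL : PolyTime L) (hlim : PolyTime lim)
    (hS : PolyTime S) : PolyTime fun a => bids (E a) (L a) (lim a) (S a) := by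
  unfold bids
  fun_prop

@[fun_prop]
theorem auctionSell {u v : α → ℕ} {S : α → List (ℕ × ℕ × ℕ)} (hu : PolyTime u) (hv : PolyTime v)
    (hS : PolyTime S) : PolyTime fun a => sell (u a) (v a) (S a) := by
  unfold sell
  fun_prop

@[fun_prop]
theorem auctionRound {E : α → List (ℕ × ℕ)} {L : α → List ℕ} {lim : α → ℕ}
    {S : α → List (ℕ × ℕ × ℕ)} (hE : PolyTime E) (hL : PolyTime L) (hlim : PolyTime lim)
    (hS : PolyTime S) : PolyTime fun a => bidRound (E a) (L a) (lim a) (S a) := by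
  unfold bidRound
  exact listCases (g := fun a (b : ℕ × ℕ) _ => sell b.1 b.2 (S a)) (by fun_prop) hS (by fun_prop)

/-- By the invariant of the auction, its states have polynomial size. -/
theorem auctionFinal {E : α → List (ℕ × ℕ)} {L R : α → List ℕ} (hE : PolyTime E)
    (hL : PolyTime L) (hR : PolyTime R) (hnd : ∀ a, (R a).Nodup) :
    PolyTime fun a => final (E a) (L a) (R a) := by
  unfold final
  refine natIterate (f := fun a S => bidRound (E a) (L a) ((R a).length + 1) S) (by fun_prop)
    (by fun_prop) (by fun_prop) ?_
  obtain ⟨p, hp⟩ := hL.exists_codeSize_le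
  obtain ⟨q, hq⟩ := hR.exists_codeSize_le
  refine ⟨q * (q + (2 * (q + 1) + 1) + (p + 3) + 3) + 1, fun a j _ => ?_⟩
  have h : Inv _ _ _ _ _ := Inv.iterate (E := E a) (L := L a) (lim := (R a).length + 1) (hnd a) j
  have hlen := (congrArg List.length h.map_fst).symm.trans (List.length_map _)
  have hqa := hq a
  have hpa := hp a
  have hRq := length_le_codeSize (R a)
  refine (codeSize_le_of_forall (m := q.eval (codeSize a) + (2 * (q.eval (codeSize a) + 1) + 1) +
    (p.eval (codeSize a) + 3) + 2) fun t ht => ?_).trans ?_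
  · have h₁ : codeSize t.1 ≤ q.eval (codeSize a) :=
      (codeSize_le_of_mem (h.map_fst ▸ List.mem_map_of_mem ht)).trans hqa
    have h₂ : codeSize t.2.1 ≤ 2 * (q.eval (codeSize a) + 1) + 1 := by
      have := h.le t ht
      rw [codeSize_nat]
      omega
    have h₃ : codeSize t.2.2 ≤ p.eval (codeSize a) + 3 := by
      rcases eq_or_ne t.2.2 0 with h0 | h0
      · rw [h0, codeSize_nat]
        omega
      · obtain ⟨u, hu, e, -⟩ := h.owner t ht h0
        have := codeSize_le_of_mem hu
        rw [codeSize_nat] at this ⊢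
        omega
    change codeSize t.1 + (codeSize t.2.1 + codeSize t.2.2 + 1) + 1 ≤ _
    omega
  · rw [← hlen]
    simp only [Polynomial.eval_add, Polynomial.eval_mul, Polynomial.eval_one,
      Polynomial.eval_ofNat]
    exact Nat.succ_le_succ (Nat.mul_le_mul (by omega) (by omega))

@[fun_prop]
theorem auctionGap {S : α → List (ℕ × ℕ × ℕ)} (hS : PolyTime S) :
    PolyTime fun a => gap (S a) := by
  unfold gap
  fun_prop

@[fun_prop]
theorem auctionLeftCover {E : α → List (ℕ × ℕ)} {L : α → List ℕ} {S : α → List (ℕ × ℕ × ℕ)}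
    {g : α → ℕ} (hE : PolyTime E) (hL : PolyTime L) (hS : PolyTime S) (hg : PolyTime g) :
    PolyTime fun a => leftCover (E a) (L a) (S a) (g a) := by
  unfold leftCover
  fun_prop

end PolyTime

/-! ### Optimal cuts -/

namespace MonotoneCut

/-- Membership of a number in a list. -/
def mem (x : ℕ) (l : List ℕ) : Bool := l.any fun y => decide (y = x)

@[simp] theorem mem_iff {x : ℕ} {l : List ℕ} : mem x l = true ↔ x ∈ l := by simp [mem]

@[simp] theorem mem_eq_false {x : ℕ} {l : List ℕ} : mem x l = false ↔ x ∉ l := by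
  rw [← mem_iff, Bool.not_eq_true]

/-- The entries of `l` that are not in `l'`. -/
def diff (l l' : List ℕ) : List ℕ := l.filter fun x => !mem x l'

/-- The constraint indices whose list of variables does not contain `a`. -/
def avoiding (a : ℕ) (Ps : List (List ℕ)) : List ℕ :=
  (List.range Ps.length).filter fun c => !mem a (Ps.getD c [])

/-- The edges of the constraint graph: from `c` to itself, and from `c` to `d` if a positive
variable of `c` is a negative variable of `d`. They are the pairs of a positive side (of `c`) and a
negative side (of `d`) that cannot both be satisfied, and the pairs of the two sides of one
constraint, of which only one is needed. -/
def edges (Ps Qs : List (List ℕ)) : List (ℕ × ℕ) :=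
  (List.range Ps.length).flatMap fun c => ((List.range Ps.length).filter fun d =>
    decide (c = d) || (Ps.getD c []).any fun x => mem x (Qs.getD d [])).map fun d => (c, d)

/-- The indices on the left of the constraint graph that are not in the minimum vertex cover. -/
def active (a₁ a₀ : ℕ) (Ps Qs : List (List ℕ)) : List ℕ :=
  diff (avoiding a₀ Ps) (Auction.leftCover (edges Ps Qs) (avoiding a₀ Ps)
    (Auction.final (edges Ps Qs) (avoiding a₀ Ps) (avoiding a₁ Qs))
    (Auction.gap (Auction.final (edges Ps Qs) (avoiding a₀ Ps) (avoiding a₁ Qs))))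

/-- The assignment in which `a₁` and the positive variables of the active constraints are true. -/
def assign (a₁ a₀ : ℕ) (Ps Qs : List (List ℕ)) (x : ℕ) : Bool :=
  decide (x = a₁) || (active a₁ a₀ Ps Qs).any fun c => mem x (Ps.getD c [])

/-- The constraint `c` is violated: not all positive variables are true and not all negative
variables are false. -/
def violated (Ps Qs : List (List ℕ)) (h : ℕ → Bool) (c : ℕ) : Bool :=
  (Ps.getD c []).any (fun x => !h x) && (Qs.getD c []).any h

theorem length_filter_range (p : ℕ → Bool) (n : ℕ) :
    ((List.range n).filter p).length = ∑ c ∈ Finset.range n, (p c).toNat := by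
  induction n with
  | zero => rfl
  | succ n ih =>
    rw [List.range_succ, List.filter_append, List.length_append, ih, Finset.sum_range_succ]
    cases h : p n <;> simp [h]

theorem length_eq_sum {l : List ℕ} {n : ℕ} (hl : l.Nodup) (h : ∀ x ∈ l, x < n) :
    l.length = ∑ c ∈ Finset.range n, (mem c l).toNat := by
  rw [← length_filter_range]
  refine List.Perm.length_eq ((List.perm_ext_iff_of_nodup hl (List.nodup_range.filter _)).2 ?_)
  intro x
  simpa using h x

variable {a₁ a₀ : ℕ} {Ps Qs : List (List ℕ)}

theorem mem_avoiding {a c : ℕ} : c ∈ avoiding a Ps ↔ c < Ps.length ∧ a ∉ Ps.getD c [] := by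
  simp [avoiding]

theorem mem_edges {c d : ℕ} : (c, d) ∈ edges Ps Qs ↔ c < Ps.length ∧ d < Ps.length ∧
    (c = d ∨ ∃ x ∈ Ps.getD c [], x ∈ Qs.getD d []) := by
  simp only [edges, List.mem_flatMap, List.mem_range, List.mem_map, List.mem_filter,
    Bool.or_eq_true, decide_eq_true_eq, List.any_eq_true, mem_iff, Prod.mk.injEq]
  constructor
  · rintro ⟨c', hc, d', ⟨hd, h⟩, rfl, rfl⟩
    exact ⟨hc, hd, h⟩
  · rintro ⟨hc, hd, h⟩
    exact ⟨c, hc, d, ⟨hd, h⟩, rfl, rfl⟩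

theorem assign_one : assign a₁ a₀ Ps Qs a₁ = true := by simp [assign]

theorem assign_zero (h : a₁ ≠ a₀) : assign a₁ a₀ Ps Qs a₀ = false := by
  simp only [assign, h.symm, decide_false, Bool.false_or, List.any_eq_false, active, diff,
    List.mem_filter, mem_avoiding]
  intro c hc
  simpa using hc.1.2

/-- Among the assignments with `a₁` true and `a₀` false, `assign` violates the fewest constraints.
Let `N` be the number of constraints, and `L` and `R` the two sides of the constraint graph,
`avoiding a₀ Ps` and `avoiding a₁ Qs`. A vertex cover `(D, C)` yields an assignment that violates at
most `N - |L| - |R| + |D| + |C|` constraints, and every assignment yields a cover for which this is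
at most the number of constraints that it violates. -/
theorem violated_assign_le (hlen : Qs.length = Ps.length) {h : ℕ → Bool}
    (h₁ : h a₁ = true) (h₀ : h a₀ = false) :
    ((List.range Ps.length).filter (violated Ps Qs (assign a₁ a₀ Ps Qs))).length ≤
      ((List.range Ps.length).filter (violated Ps Qs h)).length := by
  have hL : (avoiding a₀ Ps).Nodup := List.nodup_range.filter _
  have hR : (avoiding a₁ Qs).Nodup := List.nodup_range.filter _
  have hmemR {c : ℕ} : c ∈ avoiding a₁ Qs ↔ c < Ps.length ∧ a₁ ∉ Qs.getD c [] := by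
    rw [mem_avoiding, hlen]
  obtain ⟨C, hC, hCR, hcov, hmin⟩ := Auction.exists_rightCover (E := edges Ps Qs) hL hR
  set D := Auction.leftCover (edges Ps Qs) (avoiding a₀ Ps)
    (Auction.final (edges Ps Qs) (avoiding a₀ Ps) (avoiding a₁ Qs))
    (Auction.gap (Auction.final (edges Ps Qs) (avoiding a₀ Ps) (avoiding a₁ Qs)))
  have hactive {c : ℕ} : c ∈ active a₁ a₀ Ps Qs ↔ c ∈ avoiding a₀ Ps ∧ c ∉ D := by
    rw [active, diff, List.mem_filter, Bool.not_eq_true', mem_eq_false]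
  have hDL : D.Sublist (avoiding a₀ Ps) := List.filter_sublist
  -- The constraints with a true positive side, and those with a false positive side or a
  -- true negative variable.
  let e (c : ℕ) : Bool := (Ps.getD c []).all h
  let f (c : ℕ) : Bool := e c || (Qs.getD c []).any h
  have hcount := hmin (fun c => !e c) f (by
    intro u _ v _ huv
    obtain ⟨-, -, rfl | ⟨x, hx, hx'⟩⟩ := mem_edges.1 huv
    · cases hu : e u <;> simp [f, hu]
    · cases hu : e u
      · simp
      · right
        have hxt := List.all_eq_true.1 hu x hx
        exact Bool.or_eq_true_iff.2 (.inr (List.any_eq_true.2 ⟨x, hx', hxt⟩)))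
  rw [length_eq_sum (hL.sublist hDL) (fun x hx => (mem_avoiding.1 (hDL.subset hx)).1),
    length_eq_sum hC (fun x hx => (hmemR.1 (hCR hx)).1), avoiding, avoiding, hlen,
    List.filter_filter, List.filter_filter, length_filter_range, length_filter_range] at hcount
  rw [length_filter_range, length_filter_range]
  -- The two bounds on the number of violated constraints hold constraint by constraint.
  have hle₁ : ∀ c ∈ Finset.range Ps.length, (violated Ps Qs (assign a₁ a₀ Ps Qs) c).toNat +
      ((!mem a₀ (Ps.getD c [])).toNat + (!mem a₁ (Qs.getD c [])).toNat) ≤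
      1 + ((mem c D).toNat + (mem c C).toNat) := by
    intro c hc
    rw [Finset.mem_range] at hc
    have hself (hl : a₀ ∉ Ps.getD c []) (hr : a₁ ∉ Qs.getD c []) : c ∈ D ∨ c ∈ C :=
      hcov c (mem_avoiding.2 ⟨hc, hl⟩) c (hmemR.2 ⟨hc, hr⟩) (mem_edges.2 ⟨hc, hc, .inl rfl⟩)
    have hv : violated Ps Qs (assign a₁ a₀ Ps Qs) c = true →
        (a₀ ∉ Ps.getD c [] → c ∈ D) ∧ (a₁ ∉ Qs.getD c [] → c ∈ C) := by
      intro hv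
      simp only [violated, Bool.and_eq_true, List.any_eq_true, Bool.not_eq_true'] at hv
      obtain ⟨⟨x, hx, hxf⟩, y, hy, hyt⟩ := hv
      refine ⟨fun hl => ?_, fun hr => ?_⟩
      · by_contra hcD
        have : assign a₁ a₀ Ps Qs x = true := Bool.or_eq_true_iff.2 (.inr (List.any_eq_true.2
          ⟨c, hactive.2 ⟨mem_avoiding.2 ⟨hc, hl⟩, hcD⟩, mem_iff.2 hx⟩))
        simp [hxf] at this
      · simp only [assign, Bool.or_eq_true, decide_eq_true_eq, List.any_eq_true, mem_iff] at hyt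
        rcases hyt with rfl | ⟨d, hd, hyd⟩
        · exact absurd hy hr
        · rw [hactive] at hd
          exact (hcov d hd.1 c (hmemR.2 ⟨hc, hr⟩) (mem_edges.2 ⟨(mem_avoiding.1 hd.1).1, hc,
            .inr ⟨y, hyd, hy⟩⟩)).resolve_left hd.2
    rw [← mem_eq_false, ← mem_eq_false, ← mem_iff, ← mem_iff] at hself
    rw [← mem_eq_false, ← mem_eq_false, ← mem_iff, ← mem_iff] at hv
    generalize violated Ps Qs (assign a₁ a₀ Ps Qs) c = b₁ at *
    generalize mem a₀ (Ps.getD c []) = b₂ at *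
    generalize mem a₁ (Qs.getD c []) = b₃ at *
    generalize mem c D = b₄ at *
    generalize mem c C = b₅ at *
    revert b₁ b₂ b₃ b₄ b₅
    decide
  have hle₂ : ∀ c ∈ Finset.range Ps.length,
      1 + (((!e c) && !mem a₀ (Ps.getD c [])).toNat + (f c && !mem a₁ (Qs.getD c [])).toNat) ≤
      (violated Ps Qs h c).toNat +
        ((!mem a₀ (Ps.getD c [])).toNat + (!mem a₁ (Qs.getD c [])).toNat) := by
    intro c _
    have hviol : violated Ps Qs h c = (!e c && (Qs.getD c []).any h) := by
      simp [violated, e, List.not_all_eq_any_not]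
    have hl : mem a₀ (Ps.getD c []) = true → e c = false := by
      intro hm
      by_contra he
      have := List.all_eq_true.1 (Bool.not_eq_false _ ▸ he : e c = true) a₀ (mem_iff.1 hm)
      simp [h₀] at this
    have hr : mem a₁ (Qs.getD c []) = true → (Qs.getD c []).any h = true :=
      fun hm => List.any_eq_true.2 ⟨a₁, mem_iff.1 hm, h₁⟩
    rw [hviol]
    simp only [f]
    generalize e c = b₁ at *
    generalize (Qs.getD c []).any h = b₂ at *
    generalize mem a₀ (Ps.getD c []) = b₃ at *
    generalize mem a₁ (Qs.getD c []) = b₄ at *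
    revert hl hr
    clear hviol
    revert b₁ b₂ b₃ b₄
    decide
  have hs₁ := Finset.sum_le_sum hle₁
  have hs₂ := Finset.sum_le_sum hle₂
  simp only [Finset.sum_add_distrib] at hs₁ hs₂
  omega

end MonotoneCut

/-! ### Optimal solutions -/

/-- A 2-monotone formula: whether the disjunct of the positive literals is present, with its
coordinates, and the same for the negative literals. -/
abbrev Form : Type := (Bool × List ℕ) × (Bool × List ℕ)

namespace RawCSP

open MonotoneCut

variable (tab : List Form)

/-- The formula for the relation symbol `i`. -/
def form (i : ℕ) : Form := tab.getD i ((false, []), (false, []))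

/-- Whether the assignment `v` (the list of the values) satisfies the constraint `c`, which is a
relation symbol and a list of variables. -/
def sat (v : List Bool) (c : ℕ × List ℕ) : Bool :=
  ((form tab c.1).1.1 && (form tab c.1).1.2.all fun j => v.getD (c.2.getD j 0) false) ||
  ((form tab c.1).2.1 && (form tab c.1).2.2.all fun j => !v.getD (c.2.getD j 0) false)

/-- The number of satisfied constraints. -/
def value (cs : List (ℕ × List ℕ)) (v : List Bool) : ℕ := (cs.filter fun c => sat tab v c).length

/-- The variables of the positive literals, and `[a₀]` for an absent disjunct. -/
def posVars (a₀ : ℕ) (c : ℕ × List ℕ) : List ℕ :=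
  if (form tab c.1).1.1 = true then (form tab c.1).1.2.map fun j => c.2.getD j 0 else [a₀]

/-- The variables of the negative literals, and `[a₁]` for an absent disjunct. -/
def negVars (a₁ : ℕ) (c : ℕ × List ℕ) : List ℕ :=
  if (form tab c.1).2.1 = true then (form tab c.1).2.2.map fun j => c.2.getD j 0 else [a₁]

/-- An optimal assignment among those with `a₁` true and `a₀` false. -/
def candidate (n : ℕ) (cs : List (ℕ × List ℕ)) (a₁ a₀ : ℕ) : List Bool :=
  (List.range n).map fun x =>
    assign a₁ a₀ (cs.map fun c => posVars tab a₀ c) (cs.map fun c => negVars tab a₁ c) x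

/-- The optimal assignments for all pairs of a true and a false variable. -/
def candidates (n : ℕ) (cs : List (ℕ × List ℕ)) : List (List Bool) :=
  (List.range n).flatMap fun a₁ => ((List.range n).filter fun a₀ => !decide (a₀ = a₁)).map
    fun a₀ => candidate tab n cs a₁ a₀

/-- A best candidate. -/
def solve (n : ℕ) (cs : List (ℕ × List ℕ)) : List Bool :=
  ((candidates tab n cs).filter fun v => (candidates tab n cs).all fun v' =>
    decide (value tab cs v' ≤ value tab cs v)).headD []

variable {tab} {n : ℕ} {cs : List (ℕ × List ℕ)} {a₁ a₀ : ℕ}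

/-- All variables of the constraint `c` are less than `n`. -/
def InRange (tab : List Form) (n : ℕ) (c : ℕ × List ℕ) : Prop :=
  (∀ j ∈ (form tab c.1).1.2, c.2.getD j 0 < n) ∧ ∀ j ∈ (form tab c.1).2.2, c.2.getD j 0 < n

theorem getD_map_range (h : ℕ → Bool) {x : ℕ} (hx : x < n) :
    ((List.range n).map h).getD x false = h x := by
  simp [List.getD_eq_getElem?_getD, hx]

theorem sat_eq {h : ℕ → Bool} {c : ℕ × List ℕ} (hc : InRange tab n c) (h₁ : h a₁ = true)
    (h₀ : h a₀ = false) : sat tab ((List.range n).map h) c =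
      !((posVars tab a₀ c).any (fun x => !h x) && (negVars tab a₁ c).any h) := by
  have e₁ : ((form tab c.1).1.2.all fun j => ((List.range n).map h).getD (c.2.getD j 0) false) =
      (form tab c.1).1.2.all fun j => h (c.2.getD j 0) := by
    rw [Bool.eq_iff_iff, List.all_eq_true, List.all_eq_true]
    exact forall₂_congr fun j hj => by rw [getD_map_range h (hc.1 j hj)]
  have e₂ : ((form tab c.1).2.2.all fun j => !((List.range n).map h).getD (c.2.getD j 0) false) =
      (form tab c.1).2.2.all fun j => !h (c.2.getD j 0) := by
    rw [Bool.eq_iff_iff, List.all_eq_true, List.all_eq_true]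
    exact forall₂_congr fun j hj => by rw [getD_map_range h (hc.2 j hj)]
  rw [sat, e₁, e₂, posVars, negVars]
  cases (form tab c.1).1.1 <;> cases (form tab c.1).2.1 <;>
    simp [h₁, h₀, List.any_map, List.not_any_eq_all_not, Function.comp_def]

theorem value_add_violated {h : ℕ → Bool} (hcs : ∀ c ∈ cs, InRange tab n c) (h₁ : h a₁ = true)
    (h₀ : h a₀ = false) : value tab cs ((List.range n).map h) +
      ((List.range cs.length).filter (violated (cs.map fun c => posVars tab a₀ c)
        (cs.map fun c => negVars tab a₁ c) h)).length = cs.length := by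
  have hcs' : cs = (List.range cs.length).map fun i => cs.getD i (0, []) := by
    refine List.ext_getElem (by simp) fun i hi _ => ?_
    simp [hi]
  have hv : ((List.range cs.length).filter (violated (cs.map fun c => posVars tab a₀ c)
        (cs.map fun c => negVars tab a₁ c) h)).length =
      (cs.filter fun c => !sat tab ((List.range n).map h) c).length := by
    conv_rhs => rw [hcs', List.filter_map, List.length_map]
    refine congrArg _ (List.filter_congr fun i hi => ?_)
    rw [List.mem_range] at hi
    have : cs.getD i (0, []) ∈ cs := by simp [hi]
    rw [Function.comp_apply, sat_eq (hcs _ this) h₁ h₀, Bool.not_not, violated]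
    simp [hi]
  rw [hv, value]
  exact (List.length_eq_length_filter_add _).symm

theorem value_le_candidate (hcs : ∀ c ∈ cs, InRange tab n c) {v : List Bool} (hv : v.length = n)
    (h₁ : v.getD a₁ false = true) (h₀ : v.getD a₀ false = false) :
    value tab cs v ≤ value tab cs (candidate tab n cs a₁ a₀) := by
  have hv' : v = (List.range n).map fun x => v.getD x false := by
    refine List.ext_getElem (by simp [hv]) fun i hi _ => ?_
    simp [hi]
  have hne : a₁ ≠ a₀ := by
    rintro rfl
    rw [h₁] at h₀
    cases h₀
  have e₁ := value_add_violated hcs (h := fun x => v.getD x false) h₁ h₀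
  have e₂ := value_add_violated hcs (a₁ := a₁) (a₀ := a₀)
    (h := assign a₁ a₀ (cs.map fun c => posVars tab a₀ c) (cs.map fun c => negVars tab a₁ c))
    assign_one (assign_zero hne)
  have := violated_assign_le (a₁ := a₁) (a₀ := a₀) (Ps := cs.map fun c => posVars tab a₀ c)
    (Qs := cs.map fun c => negVars tab a₁ c) (by simp) (h := fun x => v.getD x false) h₁ h₀
  rw [← hv'] at e₁
  rw [List.length_map] at this
  change _ ≤ value tab cs ((List.range n).map (assign a₁ a₀ _ _))
  omega

theorem mem_candidates {v : List Bool} : v ∈ candidates tab n cs ↔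
    ∃ a₁ < n, ∃ a₀ < n, a₀ ≠ a₁ ∧ candidate tab n cs a₁ a₀ = v := by
  simp [candidates, and_assoc]

theorem candidate_spec (h₁ : a₁ < n) (h₀ : a₀ < n) (hne : a₀ ≠ a₁) :
    (candidate tab n cs a₁ a₀).length = n ∧ true ∈ candidate tab n cs a₁ a₀ ∧
      false ∈ candidate tab n cs a₁ a₀ :=
  ⟨by simp [candidate], List.mem_map.2 ⟨a₁, List.mem_range.2 h₁, assign_one⟩,
    List.mem_map.2 ⟨a₀, List.mem_range.2 h₀, assign_zero hne.symm⟩⟩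

theorem solve_mem (hn : 2 ≤ n) : solve tab n cs ∈ candidates tab n cs ∧
    ∀ v ∈ candidates tab n cs, value tab cs v ≤ value tab cs (solve tab n cs) := by
  obtain ⟨v, hv, hmax⟩ := (candidates tab n cs).toFinset.exists_max_image (value tab cs)
    ⟨_, List.mem_toFinset.2 (mem_candidates.2 ⟨0, by omega, 1, by omega, by omega, rfl⟩)⟩
  rw [List.mem_toFinset] at hv
  simp only [List.mem_toFinset] at hmax
  rw [solve]
  rcases h : (candidates tab n cs).filter fun v => (candidates tab n cs).all fun v' =>
    decide (value tab cs v' ≤ value tab cs v) with _ | ⟨w, l⟩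
  · have := List.filter_eq_nil_iff.1 h v hv
    simp only [List.all_eq_true, decide_eq_true_eq] at this
    exact absurd hmax this
  · have := List.mem_filter.1 (h ▸ List.mem_cons_self : w ∈ _)
    simpa using this

/-- The solution is a surjective assignment, and no surjective assignment has a greater value. -/
theorem solve_spec (hn : 2 ≤ n) (hcs : ∀ c ∈ cs, InRange tab n c) :
    (solve tab n cs).length = n ∧ true ∈ solve tab n cs ∧ false ∈ solve tab n cs ∧
    ∀ v : List Bool, v.length = n → true ∈ v → false ∈ v →
      value tab cs v ≤ value tab cs (solve tab n cs) := by
  obtain ⟨hmem, hmax⟩ := solve_mem (tab := tab) (cs := cs) hn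
  obtain ⟨a₁, h₁, a₀, h₀, hne, e⟩ := mem_candidates.1 hmem
  obtain ⟨hl, ht, hf⟩ := candidate_spec (tab := tab) (cs := cs) h₁ h₀ hne
  rw [e] at hl ht hf
  refine ⟨hl, ht, hf, fun v hv hvt hvf => ?_⟩
  obtain ⟨b₁, hb₁, hv₁⟩ := List.mem_iff_getElem.1 hvt
  obtain ⟨b₀, hb₀, hv₀⟩ := List.mem_iff_getElem.1 hvf
  refine (value_le_candidate (a₁ := b₁) (a₀ := b₀) hcs hv (by simp [hb₁, hv₁])
    (by simp [hb₀, hv₀])).trans (hmax _ (mem_candidates.2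
      ⟨b₁, hv ▸ hb₁, b₀, hv ▸ hb₀, ?_, rfl⟩))
  rintro rfl
  simp [hv₁] at hv₀

end RawCSP

namespace PolyTime

open MonotoneCut RawCSP

variable {α : Type} [TreeCode α]

@[fun_prop]
theorem mem {x : α → ℕ} {l : α → List ℕ} (hx : PolyTime x) (hl : PolyTime l) :
    PolyTime fun a => mem (x a) (l a) := by
  unfold MonotoneCut.mem
  fun_prop

@[fun_prop]
theorem diff {l l' : α → List ℕ} (hl : PolyTime l) (hl' : PolyTime l') :
    PolyTime fun a => diff (l a) (l' a) := by
  unfold MonotoneCut.diff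
  fun_prop

@[fun_prop]
theorem avoiding {x : α → ℕ} {Ps : α → List (List ℕ)} (hx : PolyTime x) (hPs : PolyTime Ps) :
    PolyTime fun a => avoiding (x a) (Ps a) := by
  unfold MonotoneCut.avoiding
  fun_prop

@[fun_prop]
theorem edges {Ps Qs : α → List (List ℕ)} (hPs : PolyTime Ps) (hQs : PolyTime Qs) :
    PolyTime fun a => edges (Ps a) (Qs a) := by
  unfold MonotoneCut.edges
  fun_prop

@[fun_prop]
theorem active {a₁ a₀ : α → ℕ} {Ps Qs : α → List (List ℕ)} (h₁ : PolyTime a₁) (h₀ : PolyTime a₀)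
    (hPs : PolyTime Ps) (hQs : PolyTime Qs) :
    PolyTime fun a => active (a₁ a) (a₀ a) (Ps a) (Qs a) := by
  have hfinal : PolyTime fun a => Auction.final (MonotoneCut.edges (Ps a) (Qs a))
      (MonotoneCut.avoiding (a₀ a) (Ps a)) (MonotoneCut.avoiding (a₁ a) (Qs a)) :=
    auctionFinal (by fun_prop) (by fun_prop) (by fun_prop) fun a => List.nodup_range.filter _
  unfold MonotoneCut.active
  fun_prop

@[fun_prop]
theorem posVars (tab : List Form) {x : α → ℕ} {c : α → ℕ × List ℕ} (hx : PolyTime x)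
    (hc : PolyTime c) : PolyTime fun a => posVars tab (x a) (c a) := by
  unfold RawCSP.posVars form
  fun_prop

@[fun_prop]
theorem negVars (tab : List Form) {x : α → ℕ} {c : α → ℕ × List ℕ} (hx : PolyTime x)
    (hc : PolyTime c) : PolyTime fun a => negVars tab (x a) (c a) := by
  unfold RawCSP.negVars form
  fun_prop

@[fun_prop]
theorem candidate (tab : List Form) {n a₁ a₀ : α → ℕ} {cs : α → List (ℕ × List ℕ)}
    (hn : PolyTime n) (hcs : PolyTime cs) (h₁ : PolyTime a₁) (h₀ : PolyTime a₀) :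
    PolyTime fun a => candidate tab (n a) (cs a) (a₁ a) (a₀ a) := by
  unfold RawCSP.candidate assign
  fun_prop

@[fun_prop]
theorem candidates (tab : List Form) {n : α → ℕ} {cs : α → List (ℕ × List ℕ)}
    (hn : PolyTime n) (hcs : PolyTime cs) : PolyTime fun a => candidates tab (n a) (cs a) := by
  unfold RawCSP.candidates
  fun_prop

@[fun_prop]
theorem value (tab : List Form) {cs : α → List (ℕ × List ℕ)} {v : α → List Bool}
    (hcs : PolyTime cs) (hv : PolyTime v) : PolyTime fun a => value tab (cs a) (v a) := by
  unfold RawCSP.value sat form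
  fun_prop

@[fun_prop]
theorem solve (tab : List Form) {n : α → ℕ} {cs : α → List (ℕ × List ℕ)}
    (hn : PolyTime n) (hcs : PolyTime cs) : PolyTime fun a => solve tab (n a) (cs a) := by
  unfold RawCSP.solve
  fun_prop

end PolyTime

/-! ### Reading instances -/

namespace RawCSP

/-- The number of a symbol. -/
def symNum {m : ℕ} : CSPSym m → ℕ
  | .one => 0
  | .sep => 1
  | .rel i => i + 2

theorem symNum_injective {m : ℕ} : Function.Injective (symNum : CSPSym m → ℕ) := by
  rintro (_ | _ | i) (_ | _ | j) h <;> simp_all [symNum, Fin.ext_iff]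

theorem symNum_lt {m : ℕ} (s : CSPSym m) : symNum s < m + 2 := by
  rcases s with _ | _ | i <;> simp [symNum]

/-- The state of the parser: the numbers and the constraints that have been read, and whether the
word is well-formed so far. -/
abbrev Parsed : Type := (List ℕ × List (ℕ × List ℕ)) × Bool

/-- Read one more symbol. -/
def parseStep (p : Parsed) (s : ℕ) : Parsed :=
  if decide (s = 0) = true then
    if decide (p.1.1.length = 0) = true then (p.1, false)
    else (((p.1.1.headD 0 + 1) :: p.1.1.tail, p.1.2), p.2)
  else if decide (s = 1) = true then ((0 :: p.1.1, p.1.2), p.2)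
  else (([], (s - 2, p.1.1) :: p.1.2), p.2)

/-- Read a word, from right to left. -/
def parse (w : List ℕ) : Parsed := w.reverse.foldl (fun p s => parseStep p s) (([], []), true)

/-- The code of a number. -/
def numWord (a : ℕ) : List ℕ := List.replicate a 0 ++ [1]

/-- The code of a constraint. -/
def conWord (c : ℕ × List ℕ) : List ℕ := (c.1 + 2) :: c.2.flatMap numWord

theorem parse_cons (s : ℕ) (w : List ℕ) : parse (s :: w) = parseStep (parse w) s := by
  simp [parse]

theorem parse_numWord_append {w : List ℕ} {l cs} {b : Bool} (h : parse w = ((l, cs), b)) (a : ℕ) :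
    parse (numWord a ++ w) = ((a :: l, cs), b) := by
  induction a with
  | zero => simp [numWord, parse_cons, h, parseStep]
  | succ a ih =>
    rw [numWord, List.replicate_succ, List.cons_append, List.cons_append, parse_cons]
    rw [numWord] at ih
    rw [ih]
    simp [parseStep]

theorem parse_flatMap_numWord_append {w : List ℕ} {cs} {b : Bool} {l' : List ℕ}
    (h : parse w = ((l', cs), b)) (l : List ℕ) :
    parse (l.flatMap numWord ++ w) = ((l ++ l', cs), b) := by
  induction l with
  | nil => exact h
  | cons a l ih =>
    rw [List.flatMap_cons, List.append_assoc]
    exact parse_numWord_append ih a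

theorem parse_flatMap_conWord (cs : List (ℕ × List ℕ)) :
    parse (cs.flatMap conWord) = (([], cs), true) := by
  induction cs with
  | nil => rfl
  | cons c cs ih =>
    rw [List.flatMap_cons, conWord, List.cons_append, parse_cons,
      parse_flatMap_numWord_append ih]
    simp [parseStep]

theorem parse_word (l : List ℕ) (cs : List (ℕ × List ℕ)) :
    parse (l.flatMap numWord ++ cs.flatMap conWord) = ((l, cs), true) := by
  simpa using parse_flatMap_numWord_append (parse_flatMap_conWord cs) l

/-- A word without errors is the code of what has been read. -/
theorem word_parse {w : List ℕ} (h : (parse w).2 = true) :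
    (parse w).1.1.flatMap numWord ++ (parse w).1.2.flatMap conWord = w := by
  induction w with
  | nil => rfl
  | cons s w ih =>
    rw [parse_cons] at h ⊢
    rcases hp : parse w with ⟨⟨l, cs⟩, b⟩
    rw [hp] at ih h
    rcases s with _ | _ | s
    · cases l with
      | nil => simp [parseStep] at h
      | cons a l =>
        simp only [parseStep, decide_true, if_true, List.length_cons, List.headD_cons,
          List.tail_cons] at h ih ⊢
        simp at h
        simpa [numWord, List.replicate_succ] using ih h
    · simp [parseStep] at h ih ⊢
      simpa [numWord] using ih h
    · simp [parseStep] at h ih ⊢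
      simpa [conWord] using ih h

/-- Whether a list of constraints has no repetition. -/
def noDup (cs : List (ℕ × List ℕ)) : Bool :=
  (List.range cs.length).all fun i => (List.range cs.length).all fun j => decide (i = j) ||
    !(decide ((cs.getD i (0, [])).1 = (cs.getD j (0, [])).1) &&
      decide ((cs.getD i (0, [])).2 = (cs.getD j (0, [])).2))

theorem noDup_iff {cs : List (ℕ × List ℕ)} : noDup cs = true ↔ cs.Nodup := by
  simp only [noDup, List.all_eq_true, List.mem_range, Bool.or_eq_true, decide_eq_true_eq,
    Bool.not_eq_true', ← Bool.decide_and, decide_eq_false_iff_not, ← Prod.ext_iff]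
  rw [List.nodup_iff_injective_get]
  constructor
  · intro h i j e
    refine Fin.ext ((h i i.2 j j.2).resolve_right (not_not_intro ?_))
    simpa using e
  · intro h i hi j hj
    by_contra! hcon
    refine hcon.1 (congrArg Fin.val (@h ⟨i, hi⟩ ⟨j, hj⟩ ?_))
    simpa [hi, hj] using hcon.2

/-- Whether a word is the code of an instance over a signature with arities `ks`, for a domain with
two elements. -/
def isInst (ks : List ℕ) (p : Parsed) : Bool :=
  p.2 && (decide (p.1.1.length = 1) && (decide (2 ≤ p.1.1.headD 0) && ((p.1.2.all fun c =>
    decide (c.1 < ks.length) && (decide (c.2.length = ks.getD c.1 0) && c.2.all fun x =>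
      decide (x < p.1.1.headD 0))) && noDup p.1.2)))

variable {m : ℕ} {k : Fin m → ℕ}

/-- A constraint as a number and a list of numbers. -/
def rawCon {n : ℕ} (c : (i : Fin m) × (Fin (k i) → Fin n)) : ℕ × List ℕ :=
  (c.1, List.ofFn fun j => (c.2 j : ℕ))

theorem rawCon_injective {n : ℕ} :
    Function.Injective (rawCon : (i : Fin m) × (Fin (k i) → Fin n) → ℕ × List ℕ) := by
  rintro ⟨i, t⟩ ⟨j, s⟩ h
  simp only [rawCon, Prod.mk.injEq, Fin.val_inj] at h
  obtain ⟨rfl, h⟩ := h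
  have := List.ofFn_injective h
  exact congrArg _ (funext fun x => Fin.ext (congrFun this x))

theorem map_symNum_encNum (a : ℕ) : (encNum m a).map symNum = numWord a := by
  simp [encNum, numWord, symNum]

theorem map_symNum_encode (A : CSPInstance k Bool) :
    A.encode.map symNum = [A.n].flatMap numWord ++ (A.constraints.map rawCon).flatMap conWord := by
  simp only [CSPInstance.encode, List.map_append, map_symNum_encNum, List.flatMap_cons,
    List.flatMap_nil, List.append_nil, List.map_flatMap, List.flatMap_map]
  refine congrArg _ (congrArg (fun f => A.constraints.flatMap f) (funext fun c => ?_))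
  simp [encConstraint, conWord, rawCon, symNum, List.map_flatMap, map_symNum_encNum]

theorem parse_encode (A : CSPInstance k Bool) :
    parse (A.encode.map symNum) = (([A.n], A.constraints.map rawCon), true) := by
  rw [map_symNum_encode, parse_word]

theorem mem_range_rawCon {n : ℕ} {c : ℕ × List ℕ} :
    (∃ c' : (i : Fin m) × (Fin (k i) → Fin n), rawCon c' = c) ↔
      c.1 < (List.ofFn k).length ∧ c.2.length = (List.ofFn k).getD c.1 0 ∧ ∀ x ∈ c.2, x < n := by
  constructor
  · rintro ⟨⟨i, t⟩, rfl⟩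
    simp [rawCon, List.mem_ofFn]
  · obtain ⟨i, l⟩ := c
    rintro ⟨hi, hl, hx⟩
    simp only [List.length_ofFn] at hi
    simp only [List.getD_eq_getElem?_getD, List.getElem?_ofFn, hi, dite_true,
      Option.getD_some] at hl
    refine ⟨⟨⟨i, hi⟩, fun j => ⟨l[j]'(by rw [hl]; exact j.2), hx _ (List.getElem_mem _)⟩⟩, ?_⟩
    simp only [rawCon, Prod.mk.injEq, true_and]
    exact List.ext_getElem (by simp [hl]) (by simp)

theorem isInst_iff {w : List (CSPSym m)} : isInst (List.ofFn k) (parse (w.map symNum)) = true ↔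
    ∃ A : CSPInstance k Bool, A.encode = w := by
  constructor
  · intro h
    rcases hp : parse (w.map symNum) with ⟨⟨l, cs⟩, b⟩
    rw [hp] at h
    simp only [isInst, Bool.and_eq_true, decide_eq_true_eq, List.all_eq_true, noDup_iff,
      ← mem_range_rawCon] at h
    obtain ⟨rfl, hl, h2, hcs, hnd⟩ := h
    obtain ⟨n, rfl⟩ := List.length_eq_one_iff.1 hl
    obtain ⟨cs, rfl⟩ : cs ∈ Set.range (List.map (rawCon (k := k) (n := n))) := by
      rw [Set.range_list_map]
      exact hcs
    refine ⟨⟨n, by simpa using h2, cs, hnd.of_map _⟩, symNum_injective.list_map ?_⟩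
    rw [map_symNum_encode, ← word_parse (w := w.map symNum) (by rw [hp]), hp]
  · rintro ⟨A, rfl⟩
    rw [parse_encode]
    simp only [isInst, Bool.and_eq_true, decide_eq_true_eq, List.all_eq_true, noDup_iff,
      ← mem_range_rawCon, true_and]
    refine ⟨rfl, by simpa using A.card_le, ?_, A.nodup.map rawCon_injective⟩
    intro c hc
    obtain ⟨c', -, rfl⟩ := List.mem_map.1 hc
    exact ⟨c', rfl⟩

end RawCSP

namespace PolyTime

open RawCSP

variable {α : Type} [TreeCode α]

@[fun_prop]
theorem parseStep {p : α → Parsed} {s : α → ℕ} (hp : PolyTime p) (hs : PolyTime s) :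
    PolyTime fun a => parseStep (p a) (s a) := by
  unfold RawCSP.parseStep
  fun_prop

theorem codeSize_parseStep_le (p : Parsed) (s : ℕ) :
    codeSize (RawCSP.parseStep p s) ≤ codeSize p + (codeSize s + 5) := by
  obtain ⟨⟨l, cs⟩, b⟩ := p
  have hpair {β γ : Type} [TreeCode β] [TreeCode γ] (x : β) (y : γ) :
    codeSize (x, y) = codeSize x + codeSize y + 1 := rfl
  have hb := codeSize_bool_le false
  rcases s with _ | _ | s
  · cases l with
    | nil =>
      simp [RawCSP.parseStep, hpair]
      omega
    | cons a l =>
      simp [RawCSP.parseStep, hpair, codeSize_nat]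
      omega
  · simp [RawCSP.parseStep, hpair, codeSize_nat]
    omega
  · simp [RawCSP.parseStep, hpair, codeSize_nat]
    omega

@[fun_prop]
theorem parse {w : α → List ℕ} (hw : PolyTime w) : PolyTime fun a => parse (w a) := by
  unfold RawCSP.parse
  refine foldl_of_growth (f := fun _ p s => RawCSP.parseStep p s) (by fun_prop) (by fun_prop)
    (by fun_prop) ?_
  obtain ⟨q, hq⟩ := hw.exists_codeSize_le
  refine ⟨q + 5, fun a p s hs => (codeSize_parseStep_le p s).trans ?_⟩
  have := codeSize_le_of_mem (List.mem_reverse.1 hs)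
  have := hq a
  simp
  omega

@[fun_prop]
theorem isInst (ks : List ℕ) {p : α → Parsed} (hp : PolyTime p) :
    PolyTime fun a => isInst ks (p a) := by
  unfold RawCSP.isInst noDup
  fun_prop

end PolyTime

/-! ### Binary numbers -/

/-- One step of adding a carry to a binary number; the state is the carry and the reversed
result. -/
def carryStep (s : Bool × List Bool) (b : Bool) : Bool × List Bool :=
  if s.1 = true then (b, (!b) :: s.2) else (false, b :: s.2)

/-- The end of an addition: the last carry becomes the leading digit. -/
def carryEnd (s : Bool × List Bool) : List Bool := (if s.1 = true then true :: s.2 else s.2).reverse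

/-- The successor of a binary number, with the least significant digit first. -/
def binSucc (l : List Bool) : List Bool := carryEnd (l.foldl (fun s b => carryStep s b) (true, []))

theorem carryEnd_foldl_false (l acc : List Bool) :
    carryEnd (l.foldl (fun s b => carryStep s b) (false, acc)) = acc.reverse ++ l := by
  induction l generalizing acc with
  | nil => simp [carryEnd]
  | cons b l ih =>
    change carryEnd (l.foldl _ (false, b :: acc)) = _
    rw [ih]
    simp

theorem carryEnd_foldl_true (l acc : List Bool) :
    carryEnd (l.foldl (fun s b => carryStep s b) (true, acc)) = acc.reverse ++ binSucc l := by
  induction l generalizing acc with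
  | nil => simp [carryEnd, binSucc]
  | cons b l ih =>
    rw [binSucc]
    change carryEnd (l.foldl _ (b, (!b) :: acc)) =
      acc.reverse ++ carryEnd (l.foldl _ (b, [!b]))
    cases b
    · rw [carryEnd_foldl_false, carryEnd_foldl_false]
      simp
    · rw [ih, ih]
      simp

theorem binSucc_true (l : List Bool) : binSucc (true :: l) = false :: binSucc l := by
  rw [binSucc, List.foldl_cons]
  exact carryEnd_foldl_true l [false]

theorem binSucc_false (l : List Bool) : binSucc (false :: l) = true :: l := by
  rw [binSucc, List.foldl_cons]
  exact carryEnd_foldl_false l [true]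

theorem encodePosNum_succ (p : PosNum) : encodePosNum p.succ = binSucc (encodePosNum p) := by
  induction p with
  | one => rfl
  | bit0 p => exact (binSucc_false _).symm
  | bit1 p ih => exact (congrArg _ ih).trans (binSucc_true _).symm

theorem encodeNat_succ (n : ℕ) : encodeNat (n + 1) = binSucc (encodeNat n) := by
  rw [encodeNat, encodeNat, show ((n + 1 : ℕ) : Num) = Num.succ n from by simp [Num.add_one]]
  rcases (n : Num) with _ | p
  · rfl
  · exact encodePosNum_succ p

theorem length_binSucc_le (l : List Bool) : (binSucc l).length ≤ l.length + 1 := by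
  induction l with
  | nil => simp [binSucc, carryEnd]
  | cons b l ih => cases b <;> simp [binSucc_true, binSucc_false, ih]

theorem binSucc_iterate (n : ℕ) : binSucc^[n] [] = encodeNat n := by
  induction n with
  | zero => rfl
  | succ n ih => rw [Function.iterate_succ_apply', ih, encodeNat_succ]

theorem length_encodeNat_le (n : ℕ) : (encodeNat n).length ≤ n := by
  induction n with
  | zero => simp [encodeNat, encodeNum]
  | succ n ih =>
    rw [encodeNat_succ]
    exact (length_binSucc_le _).trans (Nat.succ_le_succ ih)

namespace PolyTime

variable {α : Type} [TreeCode α]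

@[fun_prop]
theorem binSucc {l : α → List Bool} (hl : PolyTime l) : PolyTime fun a => binSucc (l a) := by
  have hfold : PolyTime fun a => (l a).foldl (fun s b => carryStep s b) (true, []) := by
    refine foldl_of_growth (f := fun _ s b => carryStep s b) hl (by fun_prop) ?_ ?_
    · unfold carryStep
      fun_prop
    · refine ⟨7, fun a s b _ => ?_⟩
      obtain ⟨c, t⟩ := s
      have hpair (x : Bool) (y : List Bool) : codeSize (x, y) = codeSize x + codeSize y + 1 := rfl
      have h₁ := codeSize_bool_le b
      have h₂ := codeSize_bool_le !b
      have h₃ := codeSize_bool_le false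
      have h₄ := codeSize_pos c
      cases c <;> simp [carryStep, hpair] <;> omega
  unfold _root_.binSucc carryEnd
  fun_prop

@[fun_prop]
theorem encodeNat {n : α → ℕ} (hn : PolyTime n) : PolyTime fun a => encodeNat (n a) := by
  have : PolyTime fun a => _root_.binSucc^[n a] [] := by
    refine natIterate (f := fun _ l => _root_.binSucc l) hn (by fun_prop) (by fun_prop) ?_
    obtain ⟨p, hp⟩ := hn.exists_codeSize_le
    refine ⟨p * 4 + 1, fun a j hj => ?_⟩
    change codeSize (_root_.binSucc^[j] []) ≤ _
    rw [binSucc_iterate]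
    refine (codeSize_le_of_forall fun b _ => codeSize_bool_le b).trans ?_
    have := length_encodeNat_le j
    have := hp a
    rw [codeSize_nat] at this
    simp
    omega
  simpa only [binSucc_iterate] using this

/-- Functions in polynomial time on codes are in polynomial time on multi-stack machines, for any
numbering `sym` of the input symbols. -/
theorem polyTimeComputable {α Γ : Type} [Fintype Γ] (sym : Γ → ℕ) {ea : α → List Γ}
    {f : α → List Bool} {F : List ℕ → List Bool} (hF : PolyTime F)
    (h : ∀ a, F ((ea a).map sym) = f a) : PolyTimeComputable ea f :=
  polyTimeComputable_reverse (F := fun w => (F w.reverse).reverse) sym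
    (reverse (hF.comp (reverse id))) fun a => by rw [List.reverse_reverse, h]

theorem polyTimeDecidable {α Γ : Type} [Fintype Γ] (sym : Γ → ℕ) {ea : α → List Γ}
    {S : Set α} {F : List ℕ → Bool} (hF : PolyTime F)
    (h : ∀ a, F ((ea a).map sym) = true ↔ a ∈ S) : PolyTimeDecidable ea S := by
  classical
  refine polyTimeComputable sym (F := fun w => [F w]) (by fun_prop) fun a => ?_
  rw [encodeBool, List.pure_def, List.cons.injEq]
  exact ⟨by rw [Bool.eq_iff_iff, h, decide_eq_true_iff], rfl⟩

end PolyTime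

/-! ### Max-Sur-CSP -/

section MaxSurCSP

open RawCSP

variable {m : ℕ} {k : Fin m → ℕ}

noncomputable instance : Fintype (CSPSym m) :=
  Fintype.ofInjective (fun s => (⟨symNum s, symNum_lt s⟩ : Fin (m + 2)))
    fun _ _ h => symNum_injective (congrArg Fin.val h)

/-- The formula of a 2-monotone relation, with coordinates as numbers. -/
theorem IsTwoMonotone.exists_form {r : ℕ} {R : Set (Fin r → Bool)} (hR : IsTwoMonotone R) :
    ∃ F : Form, (∀ j ∈ F.1.2, j < r) ∧ (∀ j ∈ F.2.2, j < r) ∧ ∀ t : Fin r → Bool, t ∈ R ↔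
      ((F.1.1 && F.1.2.all fun j => (List.ofFn t).getD j false) ||
        (F.2.1 && F.2.2.all fun j => !(List.ofFn t).getD j false)) = true := by
  obtain ⟨P, Q, hR⟩ := hR
  have hlt (P : Finset (Fin r)) : ∀ j ∈ P.toList.map Fin.val, j < r := by simp
  have hP (t : Fin r → Bool) : ((P.toList.map Fin.val).all fun j => (List.ofFn t).getD j false) =
      true ↔ ∀ j ∈ P, t j = true := by
    simp [List.getD_eq_getElem?_getD]
  have hQ (t : Fin r → Bool) : ((Q.toList.map Fin.val).all fun j => !(List.ofFn t).getD j false) =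
      true ↔ ∀ j ∈ Q, t j = false := by
    simp [List.getD_eq_getElem?_getD]
  rcases hR with rfl | rfl | rfl
  · exact ⟨((true, P.toList.map Fin.val), (false, [])), hlt P, by simp, fun t => by
      rw [Bool.true_and, Bool.false_and, Bool.or_false, hP]; rfl⟩
  · exact ⟨((false, []), (true, Q.toList.map Fin.val)), by simp, hlt Q, fun t => by
      rw [Bool.true_and, Bool.false_and, Bool.false_or, hQ]; rfl⟩
  · exact ⟨((true, P.toList.map Fin.val), (true, Q.toList.map Fin.val)), hlt P, hlt Q, fun t => by
      rw [Bool.true_and, Bool.true_and, Bool.or_eq_true, hP, hQ]; rfl⟩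

/-- The list `tab` contains formulas for the relations of the template `B`. -/
def IsTable (B : RelStructure k Bool) (tab : List Form) : Prop :=
  ∀ i : Fin m, (∀ j ∈ (form tab i).1.2, j < k i) ∧ (∀ j ∈ (form tab i).2.2, j < k i) ∧
    ∀ t : Fin (k i) → Bool, t ∈ B i ↔
      (((form tab i).1.1 && (form tab i).1.2.all fun j => (List.ofFn t).getD j false) ||
        ((form tab i).2.1 && (form tab i).2.2.all fun j => !(List.ofFn t).getD j false)) = true

theorem RelStructure.IsTwoMonotone.exists_isTable {B : RelStructure k Bool}
    (hB : B.IsTwoMonotone) : ∃ tab, IsTable B tab := by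
  choose F h₁ h₂ h₃ using fun i => (hB i).exists_form
  have hform (i : Fin m) : form (List.ofFn F) i = F i := by
    simp [form, List.getD_eq_getElem?_getD]
  refine ⟨List.ofFn F, fun i => ?_⟩
  rw [hform]
  exact ⟨h₁ i, h₂ i, h₃ i⟩

variable {B : RelStructure k Bool} {tab : List Form}

theorem getD_ofFn_lt {n r : ℕ} (t : Fin r → Fin n) {j : ℕ} (hj : j < r) :
    (List.ofFn fun j => (t j : ℕ)).getD j 0 = t ⟨j, hj⟩ := by
  simp [List.getD_eq_getElem?_getD, hj]

theorem IsTable.inRange (htab : IsTable B tab) {n : ℕ} (c : (i : Fin m) × (Fin (k i) → Fin n)) :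
    InRange tab n (rawCon c) := by
  refine ⟨fun j hj => ?_, fun j hj => ?_⟩
  · rw [rawCon, getD_ofFn_lt c.2 ((htab c.1).1 j hj)]
    exact Fin.is_lt _
  · rw [rawCon, getD_ofFn_lt c.2 ((htab c.1).2.1 j hj)]
    exact Fin.is_lt _

theorem IsTable.sat_rawCon (htab : IsTable B tab) {n : ℕ} (h : Fin n → Bool)
    (c : (i : Fin m) × (Fin (k i) → Fin n)) :
    sat tab (List.ofFn h) (rawCon c) = true ↔ h ∘ c.2 ∈ B c.1 := by
  obtain ⟨h₁, h₂, h₃⟩ := htab c.1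
  have key {j : ℕ} (hj : j < k c.1) :
      (List.ofFn h).getD ((List.ofFn fun j => (c.2 j : ℕ)).getD j 0) false =
        (List.ofFn (h ∘ c.2)).getD j false := by
    rw [getD_ofFn_lt c.2 hj]
    simp [List.getD_eq_getElem?_getD, hj]
  rw [h₃, sat, rawCon]
  simp only [Bool.or_eq_true, Bool.and_eq_true, List.all_eq_true]
  refine or_congr (and_congr_right fun _ => ?_) (and_congr_right fun _ => ?_)
  · exact forall₂_congr fun j hj => by rw [key (h₁ j hj)]
  · exact forall₂_congr fun j hj => by rw [key (h₂ j hj)]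

theorem IsTable.value_eq (htab : IsTable B tab) (A : CSPInstance k Bool) (h : Fin A.n → Bool) :
    value tab (A.constraints.map rawCon) (List.ofFn h) = A.numSatisfied B h := by
  classical
  have hset : {c : (i : Fin m) × (Fin (k i) → Fin A.n) |
      c.2 ∈ A.toStructure c.1 ∧ h ∘ c.2 ∈ B c.1} =
      ((A.constraints.filter fun c => sat tab (List.ofFn h) (rawCon c)).toFinset : Set _) := by
    ext c
    simp [CSPInstance.toStructure, htab.sat_rawCon]
  rw [CSPInstance.numSatisfied, hset, Set.ncard_coe_finset,
    List.toFinset_card_of_nodup (A.nodup.filter _), value, List.filter_map, List.length_map]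
  rfl

/-- The number of a symbol of the code of an instance and a solution. -/
def pairNum {m : ℕ} : CSPSym m ⊕ Bool → ℕ := Sum.elim symNum fun b => bif b then m + 3 else m + 2

/-- The code of the instance in the code of a pair. -/
def instPart (m : ℕ) (w : List ℕ) : List ℕ := w.filter fun s => decide (s < m + 2)

/-- The solution in the code of a pair. -/
def solPart (m : ℕ) (w : List ℕ) : List Bool :=
  (w.filter fun s => !decide (s < m + 2)).map fun s => decide (s = m + 3)

theorem map_pairNum_encPair (p : List (CSPSym m) × List Bool) : (encPair p).map pairNum =
    p.1.map symNum ++ p.2.map fun b => bif b then m + 3 else m + 2 := by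
  rw [encPair, List.map_append, List.map_map, List.map_map]
  rfl

theorem instPart_encPair (p : List (CSPSym m) × List Bool) :
    instPart m ((encPair p).map pairNum) = p.1.map symNum := by
  have h₁ : (p.1.map (fun s => (symNum s : ℕ))).filter (fun s => decide (s < m + 2)) =
      p.1.map symNum := List.filter_eq_self.2 (by simpa using fun s _ => symNum_lt s)
  have h₂ : (p.2.map fun b => bif b then m + 3 else m + 2).filter (fun s => decide (s < m + 2)) =
      [] := List.filter_eq_nil_iff.2 (by
        simp only [List.mem_map]
        rintro _ ⟨b, -, rfl⟩
        cases b <;> simp)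
  rw [instPart, map_pairNum_encPair, List.filter_append, h₁, h₂, List.append_nil]

theorem solPart_encPair (p : List (CSPSym m) × List Bool) :
    solPart m ((encPair p).map pairNum) = p.2 := by
  have h₁ : (p.1.map (fun s => (symNum s : ℕ))).filter (fun s => !decide (s < m + 2)) =
      [] := List.filter_eq_nil_iff.2 (by simpa using fun s _ => symNum_lt s)
  have h₂ : (p.2.map fun b => bif b then m + 3 else m + 2).filter (fun s => !decide (s < m + 2)) =
      p.2.map fun b => bif b then m + 3 else m + 2 := List.filter_eq_self.2 (by
        simp only [List.mem_map]
        rintro _ ⟨b, -, rfl⟩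
        cases b <;> simp)
  rw [solPart, map_pairNum_encPair, List.filter_append, h₁, h₂, List.nil_append, List.map_map]
  conv_rhs => rw [← List.map_id p.2]
  refine List.map_congr_left fun b _ => ?_
  cases b <;> simp

/-- Whether a list of Booleans is a surjective function on a domain with `n` elements. -/
def isSol (n : ℕ) (v : List Bool) : Bool :=
  decide (v.length = n) && ((v.any fun b => b) && v.any fun b => !b)

theorem isSol_iff {n : ℕ} {v : List Bool} :
    isSol n v = true ↔ ∃ h : Fin n → Bool, Function.Surjective h ∧ List.ofFn h = v := by
  simp only [isSol, Bool.and_eq_true, decide_eq_true_eq, List.any_eq_true, exists_eq_right,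
    Bool.not_eq_true']
  constructor
  · rintro ⟨rfl, ht, hf⟩
    refine ⟨v.get, fun b => ?_, List.ofFn_get v⟩
    cases b
    · exact List.mem_iff_get.1 hf
    · exact List.mem_iff_get.1 ht
  · rintro ⟨h, hh, rfl⟩
    simp only [List.length_ofFn, List.mem_ofFn, true_and]
    exact ⟨hh true, hh false⟩

theorem polyTimeDecidable_instances : PolyTimeDecidable
    (id : List (CSPSym m) → List (CSPSym m))
    (Set.range (CSPInstance.encode : CSPInstance k Bool → List (CSPSym m))) :=
  PolyTime.polyTimeDecidable symNum (F := fun w => isInst (List.ofFn k) (parse w)) (by fun_prop)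
    fun _ => isInst_iff

theorem polyTimeDecidable_solutions : PolyTimeDecidable
    (encPair : List (CSPSym m) × List Bool → List (CSPSym m ⊕ Bool))
    {p | ∃ (A : CSPInstance k Bool) (h : {h : Fin A.n → Bool // Function.Surjective h}),
      A.encode = p.1 ∧ List.ofFn h.1 = p.2} := by
  refine PolyTime.polyTimeDecidable pairNum (F := fun w =>
    isInst (List.ofFn k) (parse (instPart m w)) &&
      isSol ((parse (instPart m w)).1.1.headD 0) (solPart m w)) ?_ fun p => ?_
  · unfold isSol instPart solPart
    fun_prop
  · rw [instPart_encPair, solPart_encPair, Bool.and_eq_true, isInst_iff]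
    constructor
    · rintro ⟨⟨A, hA⟩, hs⟩
      rw [← hA, parse_encode, isSol_iff] at hs
      obtain ⟨h, hh, hp⟩ := hs
      exact ⟨A, ⟨h, hh⟩, hA, hp⟩
    · rintro ⟨A, ⟨h, hh⟩, hA, hp⟩
      refine ⟨⟨A, hA⟩, ?_⟩
      rw [← hA, parse_encode, isSol_iff]
      exact ⟨h, hh, hp⟩

theorem IsTable.polyTimeComputable_value (htab : IsTable B tab) : PolyTimeComputable
    (fun y : (A : CSPInstance k Bool) × {h : Fin A.n → Bool // Function.Surjective h} =>
      encPair (y.1.encode, List.ofFn y.2.1))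
    (fun y => encodeNat (y.1.numSatisfied B y.2.1)) := by
  refine PolyTime.polyTimeComputable pairNum (F := fun w =>
    encodeNat (value tab (parse (instPart m w)).1.2 (solPart m w))) ?_ fun y => ?_
  · unfold instPart solPart
    fun_prop
  · rw [instPart_encPair, solPart_encPair, parse_encode, htab.value_eq]

theorem polyTimeComputable_solve (tab : List Form) : PolyTimeComputable
    (CSPInstance.encode : CSPInstance k Bool → List (CSPSym m))
    (fun A => solve tab A.n (A.constraints.map rawCon)) :=
  PolyTime.polyTimeComputable symNum (F := fun w => solve tab ((parse w).1.1.headD 0) (parse w).1.2)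
    (by fun_prop) fun A => by
      rw [parse_encode]
      rfl

theorem length_le_length_encode (A : CSPInstance k Bool) (h : Fin A.n → Bool) :
    (List.ofFn h).length ≤ (Polynomial.X : Polynomial ℕ).eval A.encode.length := by
  simp [CSPInstance.encode, encNum]

theorem IsTable.exists_optimal (htab : IsTable B tab) (A : CSPInstance k Bool) :
    ∃ h : {h : Fin A.n → Bool // Function.Surjective h},
      (∀ x : {h : Fin A.n → Bool // Function.Surjective h},
        A.numSatisfied B x.1 ≤ A.numSatisfied B h.1) ∧
      List.ofFn h.1 = solve tab A.n (A.constraints.map rawCon) := by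
  obtain ⟨hl, ht, hf, hmax⟩ := solve_spec (tab := tab) (cs := A.constraints.map rawCon)
    (by simpa using A.card_le) (by
      intro c hc
      obtain ⟨c, -, rfl⟩ := List.mem_map.1 hc
      exact htab.inRange c)
  obtain ⟨h, hh, he⟩ := isSol_iff.1 (show isSol A.n (solve tab A.n (A.constraints.map rawCon)) =
    true by simp [isSol, hl, ht, hf])
  refine ⟨⟨h, hh⟩, fun x => ?_, he⟩
  rw [← htab.value_eq, ← htab.value_eq, he]
  exact hmax _ (by simp) (List.mem_ofFn.2 (x.2 true)) (List.mem_ofFn.2 (x.2 false))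

end MaxSurCSP

theorem mainTheorem9 {m : ℕ} {k : Fin m → ℕ} (B : RelStructure k Bool)
    (hB : B.IsTwoMonotone) : (maxSurCSP B).InPO := by
  obtain ⟨tab, htab⟩ := hB.exists_isTable
  choose opt hopt hcode using htab.exists_optimal
  refine ⟨⟨polyTimeDecidable_instances, polyTimeDecidable_solutions,
    ⟨Polynomial.X, fun A h => length_le_length_encode A h.1⟩, htab.polyTimeComputable_value⟩,
    opt, hopt, ?_⟩
  have hsolve := polyTimeComputable_solve (k := k) tab
  rwa [← funext hcode] at hsolve
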